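/- \textbf{Theorem (well-posedness of the $hp$-HDG formulation for one-field Friedrichs' systems).} \emph{Domain and mesh.} Let $d\ge 1$, $m\ge 0$, and let $\Omega\subset\mathbb R^d$ be an open set that equals the interior of its closure (for example a Lipschitz domain). Let $\Omega_h$ be a finite collection of pairwise disjoint open (affine) $d$-simplices $K$ with $\bigcup_{K}\overline K=\overline\Omega$; hanging nodes are allowed. Write $\sigma$ for the $(d-1)$-dimensional surface measure. The interior (split-sided) mortars are the sets $e=\partial K^+\cap\partial K^-$ with $\sigma(e)>0$, $K^+\ne K^-$ in $\Omega_h$; the boundary mortars are the sets $e=F\cap\partial\Omega$ with $\sigma(e)>0$, $F$ a face of some $K\in\Omega_h$. Let $\mathcal E_h=\mathcal E_h^\circ\cup\mathcal E_h^\partial$ be the set of all mortars. Let $p_K\in\mathbb N_0$ for $K\in\Omega_h$, and put $p_e=\max\{p_{K^+},p_{K^-}\}$ for $e=\partial K^+\cap\partial K^-\in\mathcal E_h^\circ$ and $p_e=p_K$ for a boundary mortar $e$ on a face of $K$. Let $\mathbf V_h$ be the space of functions that on each $K$ are $\mathbb R^m$-valued polynomials of degree $\le p_K$, and $\mathbf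 M_h$ the space of families in $\prod_{e\in\mathcal E_h}L^2(e)^m$ whose component on each $e$ is a polynomial of degree $\le p_e$. \emph{Coefficients.} Let $G,A_1,\dots,A_d:\Omega\to\mathbb R^{m\times m}$ satisfy (A.1) $G\in L^\infty(\Omega)^{m\times m}$; (A.2) $A_k\in L^\infty(\Omega)^{m\times m}$ for all $k$, and the distributional derivative $\sum_k\partial_kA_k$ is in $L^\infty(\Omega)^{m\times m}$; (A.3) $A_k=A_k^T$ a.e. in $\Omega$; (A.4) there is $\mu_0>0$ with $G+G^T+\sum_k\partial_kA_k\ge 2\mu_0 I_m$ a.e. in $\Omega$. Here $B\ge C$ means $v^T(B-C)v\ge0$ for all $v\in\mathbb R^m$. For $K\in\Omega_h$ let $A=\sum_k n_kA_k\in L^\infty(\partial K)^{m\times m}$ be the normal trace with respect to the unit outward normal $\mathbf n$ of $K$, that is, the bounded function on $\partial K$ with $\sum_k\int_K A_k\,\partial_k\varphi+\int_K\big(\sum_k\partial_kA_k\big)\varphi=\int_{\partial K}A\,\varphi\,d\sigma$ for all $\varphi\in C_c^\infty(\mathbb R^d)$; it depends on $K$. Let $|A|=R|\Lambda|R^{-1}$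 for the eigendecomposition $A=R\Lambda R^{-1}$. Assume that $A$ is continuous across the skeleton (the traces from the two sides of an interior mortar, taken with their own outward normals, are opposite a.e.) and that $\operatorname{Null}(A)=\{0\}$ a.e. on $\partial K$ for every $K$. Let $M\in L^\infty(\partial\Omega)^{m\times m}$ with $M\ge0$ a.e. on $\partial\Omega$ (for instance $M=|A|$), and let $\mathbf f\in L^2(\Omega)^m$, $\mathbf g\in L^2(\partial\Omega)^m$ (for instance $\mathbf g=0$). \emph{Conclusion.} There is exactly one pair $(\mathbf z_h,\widehat{\mathbf z}_h)\in\mathbf V_h\times\mathbf M_h$ such that, for all $(\mathbf w_h,\widehat{\mathbf w}_h)\in\mathbf V_h\times\mathbf M_h$, \[ -\sum_{k=1}^d\sum_K(A_k\mathbf z_h,\partial_k\mathbf w_h)_K+\sum_K(G\mathbf z_h,\mathbf w_h)_K+\sum_K\sum_{e\subset\partial K}\langle A\mathbf z_h+|A|(\mathbf z_h-\widehat{\mathbf z}_h),\mathbf w_h\rangle_e=\sum_K(\mathbf f,\mathbf w_h)_K, \] \[ \sum_{e\in\mathcal E_h}\langle[\![A\mathbf z_h+|A|(\mathbf z_h-\widehat{\mathbf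 z}_h)]\!],\widehat{\mathbf w}_h\rangle_e=-\sum_{e\in\mathcal E_h^\partial}\langle\tfrac12(A-M)\mathbf g,\widehat{\mathbf w}_h\rangle_e+\sum_{e\in\mathcal E_h^\partial}\langle\tfrac12(A+M)\widehat{\mathbf z}_h,\widehat{\mathbf w}_h\rangle_e, \] where $(\cdot,\cdot)_K$, $\langle\cdot,\cdot\rangle_e$ are the $L^2$ inner products, $e\subset\partial K$ runs over the mortars of $K$, and $[\![\cdot]\!]$ is the sum of the values from the two adjacent elements on an interior mortar, and the single value on a boundary mortar. -/

import Mathlib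

open scoped MeasureTheory ContDiff Matrix ENNReal

noncomputable section

namespace HDG

/-! ### One-field Friedrichs' systems -/

/-- `ℝ^d` with its Euclidean structure. -/
abbrev Space (d : ℕ) := EuclideanSpace ℝ (Fin d)

/-- The partial derivative `∂_k φ` of a real function on `ℝ^d`. -/
def partialDeriv {d : ℕ} (k : Fin d) (φ : Space d → ℝ) (x : Space d) : ℝ :=
  fderiv ℝ φ x (EuclideanSpace.single k 1)

/-- `B ≥ 0` for a (not necessarily symmetric) real square matrix: `v ⬝ B v ≥ 0` for all `v`. -/
def SemiPositive {m : ℕ} (B : Matrix (Fin m) (Fin m) ℝ) : Prop :=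
  ∀ v : Fin m → ℝ, 0 ≤ v ⬝ᵥ (B *ᵥ v)

/-- All entries of the matrix-valued function `B` belong to `L^∞(μ)`. -/
def EssBounded {d m : ℕ} (B : Space d → Matrix (Fin m) (Fin m) ℝ)
    (μ : MeasureTheory.Measure (Space d)) : Prop :=
  ∀ i j, MeasureTheory.MemLp (fun x => B x i j) ∞ μ

/-- `D = ∑_k ∂_k A_k` on the open set `Ω` in the sense of distributions. -/
def IsWeakDivergence {d m : ℕ} (Ω : Set (Space d))
    (A : Fin d → Space d → Matrix (Fin m) (Fin m) ℝ)
    (D : Space d → Matrix (Fin m) (Fin m) ℝ) : Prop :=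
  ∀ φ : Space d → ℝ, ContDiff ℝ ∞ φ → HasCompactSupport φ → tsupport φ ⊆ Ω →
    ∀ i j, (∑ k, ∫ x in Ω, A k x i j * partialDeriv k φ x) = - (∫ x in Ω, D x i j * φ x)

/-- The standing assumptions on the coefficients `A_k`, `G` of a one-field Friedrichs' system
on `Ω`, where `D` denotes `∑_k ∂_k A_k`. -/
structure IsOneFieldFriedrichs {d m : ℕ} (Ω : Set (Space d))
    (A : Fin d → Space d → Matrix (Fin m) (Fin m) ℝ)
    (D G : Space d → Matrix (Fin m) (Fin m) ℝ) : Prop where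
  G_bounded : EssBounded G (MeasureTheory.volume.restrict Ω)
  A_bounded : ∀ k, EssBounded (A k) (MeasureTheory.volume.restrict Ω)
  div_A : IsWeakDivergence Ω A D
  D_bounded : EssBounded D (MeasureTheory.volume.restrict Ω)
  A_symm : ∀ k, ∀ᵐ x ∂(MeasureTheory.volume.restrict Ω), (A k x)ᵀ = A k x
  coercive : ∃ μ₀ : ℝ, 0 < μ₀ ∧ ∀ᵐ x ∂(MeasureTheory.volume.restrict Ω),
    SemiPositive (G x + (G x)ᵀ + D x - (2 * μ₀) • (1 : Matrix (Fin m) (Fin m) ℝ))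

/-- The `(d-1)`-dimensional surface measure on `ℝ^d` (normalised Hausdorff measure). -/
def surf (d : ℕ) : MeasureTheory.Measure (Space d) := μHE[d - 1]

/-- `a` is (a representative of) the normal trace `∑_k n_k A_k` on `∂K`, with `n` the unit outward
normal of the open set `K`, of bounded fields `A_k` with bounded divergence `D = ∑_k ∂_k A_k`:
`a` is the bounded function on `∂K`, unique up to surface-null sets, such that
`∑_k ∫_K A_k ∂_k φ + ∫_K D φ = ∫_∂K a φ` for all test functions `φ` on `ℝ^d`. -/
structure IsNormalTrace {d m : ℕ} (K : Set (Space d))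
    (A : Fin d → Space d → Matrix (Fin m) (Fin m) ℝ)
    (D a : Space d → Matrix (Fin m) (Fin m) ℝ) : Prop where
  bounded : EssBounded a ((surf d).restrict (frontier K))
  green : ∀ φ : Space d → ℝ, ContDiff ℝ ∞ φ → HasCompactSupport φ → ∀ i j,
    (∑ k, ∫ x in K, A k x i j * partialDeriv k φ x) + (∫ x in K, D x i j * φ x)
      = ∫ x in frontier K, a x i j * φ x ∂(surf d)

open Classical in
/-- `|B| = R |Λ| R⁻¹` for a symmetric matrix `B = R Λ R⁻¹` with orthonormal eigenvectors
(and the irrelevant value `0` for a matrix that is not symmetric). -/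
def absMat {m : ℕ} (B : Matrix (Fin m) (Fin m) ℝ) : Matrix (Fin m) (Fin m) ℝ :=
  if h : B.IsHermitian then
    (h.eigenvectorUnitary : Matrix (Fin m) (Fin m) ℝ)
      * Matrix.diagonal (fun i => |h.eigenvalues i|)
      * star (h.eigenvectorUnitary : Matrix (Fin m) (Fin m) ℝ)
  else 0

/-! ### Affine simplicial partitions and their split-sided mortars -/

/-- The open simplex spanned by the vertices of `s`. -/
def openSimplex {d : ℕ} (s : Affine.Simplex ℝ (Space d) d) : Set (Space d) :=
  interior (convexHull ℝ (Set.range s.points))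

/-- The closed face of the simplex `s` opposite to its vertex number `k`. -/
def face {d : ℕ} (s : Affine.Simplex ℝ (Space d) d) (k : Fin (d + 1)) : Set (Space d) :=
  convexHull ℝ (s.points '' {j | j ≠ k})

/-- A finite partition of `Ω` into disjoint open simplices. Nothing is assumed on how the closures
of two elements meet, so that hanging nodes are allowed. -/
structure Partition (d : ℕ) (Ω : Set (Space d)) where
  /-- the number of elements -/
  N : ℕ
  /-- the simplices -/
  simplex : Fin N → Affine.Simplex ℝ (Space d) d
  disjoint : ∀ i j, i ≠ j → Disjoint (openSimplex (simplex i)) (openSimplex (simplex j))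
  cover : ⋃ i, closure (openSimplex (simplex i)) = closure Ω

variable {d : ℕ} {Ω : Set (Space d)}

/-- The element number `i`, an open set. -/
def Partition.elem (T : Partition d Ω) (i : Fin T.N) : Set (Space d) :=
  openSimplex (T.simplex i)

/-- Interior mortars: `∂K⁻ ∩ ∂K⁺` for each (unordered) pair of neighbouring elements,
i.e. pairs for which this set has positive surface measure. -/
def Partition.IntMortar (T : Partition d Ω) : Type :=
  {q : Fin T.N × Fin T.N // q.1 < q.2 ∧
    0 < surf d (frontier (T.elem q.1) ∩ frontier (T.elem q.2))}

/-- Boundary mortars: `F ∩ ∂Ω` for each face `F` of an element for which this set has positive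
surface measure. -/
def Partition.BdMortar (T : Partition d Ω) : Type :=
  {q : Fin T.N × Fin (d + 1) // 0 < surf d (face (T.simplex q.1) q.2 ∩ frontier Ω)}

instance (T : Partition d Ω) : Fintype T.IntMortar :=
  @Subtype.fintype _ _ (Classical.decPred _) _

instance (T : Partition d Ω) : Fintype T.BdMortar :=
  @Subtype.fintype _ _ (Classical.decPred _) _

/-- The mesh skeleton: all mortars. -/
abbrev Partition.Mortar (T : Partition d Ω) : Type := T.IntMortar ⊕ T.BdMortar

/-- The point set of a mortar. -/
def Partition.carrier (T : Partition d Ω) : T.Mortar → Set (Space d)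
  | .inl e => frontier (T.elem e.1.1) ∩ frontier (T.elem e.1.2)
  | .inr e => face (T.simplex e.1.1) e.1.2 ∩ frontier Ω

/-- The elements adjacent to a mortar: two for an interior mortar, one for a boundary mortar. -/
def Partition.sides (T : Partition d Ω) : T.Mortar → Finset (Fin T.N)
  | .inl e => {e.1.1, e.1.2}
  | .inr e => {e.1.1}

/-- The degree on a mortar: `max {p_{K⁺}, p_{K⁻}}` in the interior, `p_K` on the boundary. -/
def Partition.mortarDeg (T : Partition d Ω) (p : Fin T.N → ℕ) : T.Mortar → ℕ
  | .inl e => max (p e.1.1) (p e.1.2)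
  | .inr e => p e.1.1

/-! ### Approximation spaces -/

/-- The value at `x` of a vector of polynomials in `d` variables. -/
def polyEval {d m : ℕ} (q : Fin m → MvPolynomial (Fin d) ℝ) (x : Space d) : Fin m → ℝ :=
  fun i => MvPolynomial.eval (fun k => x k) (q i)

/-- Vector-valued polynomials of degree at most `p` on an element. Elements have non-empty interior,
so the polynomial functions on an element are identified with the polynomials themselves. -/
abbrev VecPoly (d m p : ℕ) : Type := Fin m → MvPolynomial.restrictTotalDegree (Fin d) ℝ p

/-- The values of a vector-valued polynomial, on an element and (traces) on its boundary. -/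
def VecPoly.val {d m p : ℕ} (z : VecPoly d m p) : Space d → Fin m → ℝ :=
  polyEval fun i => (z i : MvPolynomial (Fin d) ℝ)

/-- The partial derivative `∂_k z` of a vector-valued polynomial. -/
def VecPoly.deriv {d m p : ℕ} (k : Fin d) (z : VecPoly d m p) : Space d → Fin m → ℝ :=
  polyEval fun i => MvPolynomial.pderiv k (z i : MvPolynomial (Fin d) ℝ)

/-- The elements of `L²(e)^m` that are (restrictions to `e` of) polynomials of degree at most `p`,
with respect to the surface measure on `e`. -/
def polyTrace {d : ℕ} (m p : ℕ) (e : Set (Space d)) :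
    Submodule ℝ (MeasureTheory.Lp (Fin m → ℝ) 2 ((surf d).restrict e)) where
  carrier := {f | ∃ q : VecPoly d m p, f =ᵐ[(surf d).restrict e] q.val}
  zero_mem' := by
    refine ⟨0, ?_⟩
    filter_upwards [MeasureTheory.Lp.coeFn_zero (Fin m → ℝ) 2 ((surf d).restrict e)] with x hx
    rw [hx]
    ext i
    simp [VecPoly.val, polyEval]
  add_mem' := by
    rintro f g ⟨q, hq⟩ ⟨r, hr⟩
    refine ⟨q + r, ?_⟩
    filter_upwards [MeasureTheory.Lp.coeFn_add f g, hq, hr] with x hx h1 h2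
    rw [hx, Pi.add_apply, h1, h2]
    ext i
    simp [VecPoly.val, polyEval]
  smul_mem' := by
    rintro c f ⟨q, hq⟩
    refine ⟨c • q, ?_⟩
    filter_upwards [MeasureTheory.Lp.coeFn_smul c f, hq] with x hx h1
    rw [hx, Pi.smul_apply, h1]
    ext i
    simp [VecPoly.val, polyEval]

/-- The volume space: piecewise polynomials of degree at most `p_K` on `K`, values in `ℝ^m`. -/
abbrev Partition.VolSpace (T : Partition d Ω) (m : ℕ) (p : Fin T.N → ℕ) : Type :=
  ∀ i : Fin T.N, VecPoly d m (p i)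

/-- The trace space: polynomials of degree at most `p_e` on each mortar `e`, values in `ℝ^m`. -/
abbrev Partition.TraceSpace (T : Partition d Ω) (m : ℕ) (p : Fin T.N → ℕ) : Type :=
  ∀ e : T.Mortar, polyTrace m (T.mortarDeg p e) (T.carrier e)

/-! ### The scheme -/

/-- The upwind HDG flux `A z + |A| (z - ẑ)` seen from element `i`, at a point of mortar `e`. -/
def Partition.flux (T : Partition d Ω) {m : ℕ} {p : Fin T.N → ℕ}
    (a : Fin T.N → Space d → Matrix (Fin m) (Fin m) ℝ)
    (z : T.VolSpace m p) (zh : T.TraceSpace m p) (i : Fin T.N) (e : T.Mortar)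
    (x : Space d) : Fin m → ℝ :=
  a i x *ᵥ (z i).val x + absMat (a i x) *ᵥ ((z i).val x - (zh e).1 x)

/-- The local equations, tested with every `w` in the volume space:
`-∑_k (A_k z, ∂_k w) + (G z, w) + ⟨A z + |A| (z - ẑ), w⟩ = (f, w)`, where `⟨·,·⟩` is the sum over
the elements `K` of the sums over the mortars of `∂K`. -/
def Partition.LocalEq (T : Partition d Ω) {m : ℕ} {p : Fin T.N → ℕ}
    (A : Fin d → Space d → Matrix (Fin m) (Fin m) ℝ)
    (G : Space d → Matrix (Fin m) (Fin m) ℝ)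
    (a : Fin T.N → Space d → Matrix (Fin m) (Fin m) ℝ) (f : Space d → Fin m → ℝ)
    (z : T.VolSpace m p) (zh : T.TraceSpace m p) : Prop :=
  ∀ w : T.VolSpace m p,
    - (∑ k, ∑ i, ∫ x in T.elem i, (A k x *ᵥ (z i).val x) ⬝ᵥ (w i).deriv k x)
      + (∑ i, ∫ x in T.elem i, (G x *ᵥ (z i).val x) ⬝ᵥ (w i).val x)
      + (∑ i, ∑ e : T.Mortar with i ∈ T.sides e,
          ∫ x in T.carrier e, T.flux a z zh i e x ⬝ᵥ (w i).val x ∂(surf d))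
      = ∑ i, ∫ x in T.elem i, f x ⬝ᵥ (w i).val x

/-- The global equations, tested with every `ŵ` in the trace space:
`⟨⟦A z + |A| (z - ẑ)⟧, ŵ⟩ = -⟨½ (A - M) g, ŵ⟩ + ⟨½ (A + M) ẑ, ŵ⟩`, with the left-hand side taken
over all mortars and the right-hand side over the boundary mortars. -/
def Partition.GlobalEq (T : Partition d Ω) {m : ℕ} {p : Fin T.N → ℕ}
    (a : Fin T.N → Space d → Matrix (Fin m) (Fin m) ℝ)
    (M : Space d → Matrix (Fin m) (Fin m) ℝ) (g : Space d → Fin m → ℝ)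
    (z : T.VolSpace m p) (zh : T.TraceSpace m p) : Prop :=
  ∀ wh : T.TraceSpace m p,
    (∑ e : T.Mortar,
        ∫ x in T.carrier e, (∑ i ∈ T.sides e, T.flux a z zh i e x) ⬝ᵥ (wh e).1 x ∂(surf d))
      = - (∑ b : T.BdMortar, ∫ x in T.carrier (.inr b),
            (((1 / 2 : ℝ) • (a b.1.1 x - M x)) *ᵥ g x) ⬝ᵥ (wh (.inr b)).1 x ∂(surf d))
        + (∑ b : T.BdMortar, ∫ x in T.carrier (.inr b),
            (((1 / 2 : ℝ) • (a b.1.1 x + M x)) *ᵥ (zh (.inr b)).1 x) ⬝ᵥ (wh (.inr b)).1 x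
              ∂(surf d))

end HDG

end

/-!
The unknowns range over finite-dimensional spaces and the equations are linear, with as many
equations as unknowns, so it suffices that the homogeneous scheme has only the trivial solution
(`HDG.Partition.eq_zero_of_homogeneous`). This is an energy argument. Test the local equations with
`z` and subtract the global ones tested with `ẑ`. As the `A_k` are symmetric, integration by parts
on each element (`HDG.IsNormalTrace.two_mul_advection`) turns the advection term into
`½ (D z, z) - ½ ⟨A z, z⟩`, and with `δ = z - ẑ` there remains

`∑_K ½ ((G + Gᵀ + D) z, z) + ∑_K ⟨(½ A + |A|) δ, δ⟩ - ∑_K ½ ⟨A ẑ, ẑ⟩ + ∑_∂Ω ½ ⟨(A + M) ẑ, ẑ⟩ = 0`.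

The terms `⟨A ẑ, ẑ⟩` cancel between the two sides of an interior mortar, where the traces are
opposite, and against the boundary term on `∂Ω` (`HDG.Partition.energy_identity`). The remaining
terms are nonnegative, so each vanishes. Coercivity gives `z = 0`, and `½ A + |A| ≥ ½ |A|` together
with the triviality of `Null(A)` gives `δ = 0`, hence `ẑ = 0` on every mortar.

Three facts support this computation.

* The mortars of an element tile its boundary up to surface-null sets, so that integrals over `∂K`
  split (`HDG.Partition.integral_frontier_elem`). Almost every point of the skeleton is regular: it
  lies on a single facet hyperplane, because distinct hyperplanes meet in null sets. Near such a
  point every adjacent element is a half ball. Disjointness then allows at most two of them, and two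
  fill a neighbourhood, which puts the point into `Ω`, the interior of its closure. Conversely, a
  boundary point of an element inside `Ω` has a second element on the other side.
* The normal traces are symmetric (`HDG.IsNormalTrace.symm`), by testing the Green identity, so that
  their absolute value is the spectral one.
* The matrix field `|A|` is measurable and bounded (`HDG.EssBounded.absMat`). It is a pointwise
  limit of polynomials in `A`, by Weierstrass' theorem, and `|A|² = A²` bounds its entries.
-/

namespace HDG

/-! ### Hyperplanes and the surface measure -/

open MeasureTheory Filter Topology in
/-- Two distinct hyperplanes meet in a set of zero surface measure, which is an affine subspace of
Hausdorff dimension at most `d - 2`. -/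
theorem surf_null_of_not_proportional {d : ℕ} (hd : 1 ≤ d) (l l' : Space d →ᵃ[ℝ] ℝ)
    (hl : l.linear ≠ 0) (hl' : l'.linear ≠ 0)
    (h : ¬ ∃ c : ℝ, c ≠ 0 ∧ ∀ x, l' x = c * l x) :
    surf d {x | l x = 0 ∧ l' x = 0} = 0 := by
  set s : Set (Space d) := {x | l x = 0 ∧ l' x = 0} with hs
  rcases s.eq_empty_or_nonempty with he | ⟨x₀, hx₀⟩
  · rw [he, measure_empty]
  have key : ∀ (l : Space d →ᵃ[ℝ] ℝ) (x y : Space d), l.linear (x - y) = l x - l y := by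
    intro l x y
    exact l.linearMap_vsub x y
  have hspan : vectorSpan ℝ s ≤ LinearMap.ker l.linear ⊓ LinearMap.ker l'.linear := by
    rw [vectorSpan, Submodule.span_le]
    rintro _ ⟨x, hx, y, hy, rfl⟩
    simp only [vsub_eq_sub, SetLike.mem_coe, Submodule.mem_inf, LinearMap.mem_ker, key]
    exact ⟨by rw [hx.1, hy.1, sub_zero], by rw [hx.2, hy.2, sub_zero]⟩
  have hkd : Module.finrank ℝ (LinearMap.ker l.linear) + 1 = d := by
    have h1 := Module.Dual.finrank_ker_add_one_of_ne_zero hl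
    simpa using h1
  have hlt : LinearMap.ker l.linear ⊓ LinearMap.ker l'.linear < LinearMap.ker l.linear := by
    refine lt_of_le_of_ne inf_le_left fun heq => h ?_
    have hle : LinearMap.ker l.linear ≤ LinearMap.ker l'.linear := by
      rw [← heq]; exact inf_le_right
    have hmem : l'.linear ∈ Submodule.span ℝ (Set.range fun _ : Unit => l.linear) :=
      mem_span_of_iInf_ker_le_ker (by simpa using hle)
    rw [Set.range_const, Submodule.mem_span_singleton] at hmem
    obtain ⟨c, hc⟩ := hmem
    refine ⟨c, fun h0 => hl' (by rw [← hc, h0, zero_smul]), fun x => ?_⟩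
    have h1 := key l' x x₀
    rw [← hc, LinearMap.smul_apply, key l x x₀, hx₀.1, hx₀.2, sub_zero, sub_zero] at h1
    exact h1.symm
  have hfin := (Submodule.finrank_mono hspan).trans_lt (Submodule.finrank_lt_finrank_of_lt hlt)
  have hconv : Convex ℝ s := by
    intro x hx y hy a b _ _ hab
    have : ∀ (l : Space d →ᵃ[ℝ] ℝ), l (a • x + b • y) = a * l x + b * l y := fun l =>
      Convex.combo_affine_apply hab
    exact ⟨by rw [this, hx.1, hy.1]; simp, by rw [this, hx.2, hy.2]; simp⟩
  have hdim : dimH s < ((d - 1 : ℕ) : NNReal) := by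
    rw [Real.Convex.dimH_eq_finrank_vectorSpan hconv ⟨x₀, hx₀⟩]
    norm_cast
    omega
  have h0 := hausdorffMeasure_of_dimH_lt hdim
  rw [surf, Measure.euclideanHausdorffMeasure_def, Measure.smul_apply]
  rw [NNReal.coe_natCast] at h0
  rw [h0, smul_zero]

open MeasureTheory in
/-- A bounded part of a hyperplane has finite surface measure, which is the Lebesgue measure of the
direction of the hyperplane. -/
theorem surf_lt_top_of_isBounded {d : ℕ} (l : Space d →ᵃ[ℝ] ℝ) (hl : l.linear ≠ 0)
    {s : Set (Space d)} (hb : Bornology.IsBounded s) (hs : ∀ x ∈ s, l x = 0) :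
    surf d s < ⊤ := by
  rcases s.eq_empty_or_nonempty with he | ⟨x₀, hx₀⟩
  · rw [he, measure_empty]; exact ENNReal.zero_lt_top
  set W := LinearMap.ker l.linear
  have hkd : Module.finrank ℝ W = d - 1 := by
    have h1 := Module.Dual.finrank_ker_add_one_of_ne_zero hl
    simp only [finrank_euclideanSpace, Fintype.card_fin] at h1
    change Module.finrank ℝ W + 1 = d at h1
    omega
  let e : W → Space d := fun w => (w : Space d) + x₀
  have he : Isometry e := fun x y => by simp [e, Subtype.edist_eq]
  have himg : e '' (e ⁻¹' s) = s := by
    rw [Set.image_preimage_eq_iff]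
    intro x hx
    refine ⟨⟨x - x₀, ?_⟩, by simp [e]⟩
    have h1 : l.linear (x - x₀) = l x - l x₀ := l.linearMap_vsub x x₀
    rw [LinearMap.mem_ker, h1, hs x hx, hs x₀ hx₀, sub_zero]
  rw [surf, ← himg, he.euclideanHausdorffMeasure_image, ← hkd,
    InnerProductSpace.euclideanHausdorffMeasure_eq_volume]
  exact (he.antilipschitz.isBounded_preimage hb).measure_lt_top

/-! ### Barycentric coordinates on the elements -/

/-- The vertices of a full-dimensional simplex as an affine basis of `ℝ^d`. -/
def vertexBasis {d : ℕ} (s : Affine.Simplex ℝ (Space d) d) :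
    AffineBasis (Fin (d + 1)) ℝ (Space d) :=
  ⟨s.points, s.independent, by
    rw [s.independent.affineSpan_eq_top_iff_card_eq_finrank_add_one]; simp⟩

/-- The barycentric coordinate of `ℝ^d` belonging to the vertex number `k` of `s`. -/
noncomputable def bary {d : ℕ} (s : Affine.Simplex ℝ (Space d) d) (k : Fin (d + 1)) :
    Space d →ᵃ[ℝ] ℝ :=
  (vertexBasis s).coord k

theorem bary_points {d : ℕ} (s : Affine.Simplex ℝ (Space d) d) (k j : Fin (d + 1)) :
    bary s k (s.points j) = if k = j then 1 else 0 :=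
  (vertexBasis s).coord_apply k j

theorem bary_continuous {d : ℕ} (s : Affine.Simplex ℝ (Space d) d) (k : Fin (d + 1)) :
    Continuous (bary s k) :=
  (bary s k).continuous_of_finiteDimensional

theorem bary_linear_ne_zero {d : ℕ} (hd : 1 ≤ d) (s : Affine.Simplex ℝ (Space d) d)
    (k : Fin (d + 1)) : (bary s k).linear ≠ 0 := by
  intro h
  have : Nontrivial (Fin (d + 1)) := Fin.nontrivial_iff_two_le.mpr (by omega)
  obtain ⟨j, hj⟩ := exists_ne k
  have h1 := (bary s k).linearMap_vsub (s.points k) (s.points j)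
  rw [h, bary_points, bary_points] at h1
  simp [hj.symm] at h1

theorem openSimplex_eq {d : ℕ} (s : Affine.Simplex ℝ (Space d) d) :
    openSimplex s = {x | ∀ k, 0 < bary s k x} :=
  (vertexBasis s).interior_convexHull

theorem openSimplex_nonempty {d : ℕ} (s : Affine.Simplex ℝ (Space d) d) :
    (openSimplex s).Nonempty := by
  have h := (vertexBasis s).tot
  exact interior_convexHull_nonempty_iff_affineSpan_eq_top.mpr h

theorem isOpen_openSimplex {d : ℕ} (s : Affine.Simplex ℝ (Space d) d) :
    IsOpen (openSimplex s) := isOpen_interior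

theorem closure_openSimplex {d : ℕ} (s : Affine.Simplex ℝ (Space d) d) :
    closure (openSimplex s) = {x | ∀ k, 0 ≤ bary s k x} := by
  rw [openSimplex, (convex_convexHull ℝ _).closure_interior_eq_closure_of_nonempty_interior
    (openSimplex_nonempty s), IsClosed.closure_eq]
  · exact (vertexBasis s).convexHull_eq_nonneg_coord
  · exact ((Set.finite_range s.points).isCompact_convexHull (𝕜 := ℝ)).isClosed

theorem isBounded_closure_openSimplex {d : ℕ} (s : Affine.Simplex ℝ (Space d) d) :
    Bornology.IsBounded (closure (openSimplex s)) := by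
  refine (((Set.finite_range s.points).isCompact_convexHull (𝕜 := ℝ)).isBounded.subset
    interior_subset).closure

theorem frontier_openSimplex {d : ℕ} (s : Affine.Simplex ℝ (Space d) d) :
    frontier (openSimplex s) = {x | (∀ k, 0 ≤ bary s k x) ∧ ∃ k, bary s k x = 0} := by
  rw [(isOpen_openSimplex s).frontier_eq, closure_openSimplex, openSimplex_eq]
  ext x
  simp only [Set.mem_sdiff, Set.mem_ofPred_eq, not_forall, not_lt]
  constructor
  · rintro ⟨h, k, hk⟩
    exact ⟨h, k, le_antisymm hk (h k)⟩
  · rintro ⟨h, k, hk⟩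
    exact ⟨h, k, hk.le⟩

theorem face_eq {d : ℕ} (s : Affine.Simplex ℝ (Space d) d) (k : Fin (d + 1)) :
    face s k = {x | (∀ j, 0 ≤ bary s j x) ∧ bary s k x = 0} := by
  apply Set.Subset.antisymm
  · refine convexHull_min ?_ ?_
    · rintro _ ⟨j, hj, rfl⟩
      refine ⟨fun i => ?_, ?_⟩
      · rw [bary_points]; split_ifs <;> norm_num
      · rw [bary_points, if_neg (Ne.symm hj)]
    · intro x hx y hy a b ha hb hab
      have : ∀ (l : Space d →ᵃ[ℝ] ℝ), l (a • x + b • y) = a * l x + b * l y := fun l =>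
        Convex.combo_affine_apply hab
      refine ⟨fun j => ?_, ?_⟩
      · rw [this]
        exact add_nonneg (mul_nonneg ha (hx.1 j)) (mul_nonneg hb (hy.1 j))
      · rw [this, hx.2, hy.2]; simp
  · rintro x ⟨h0, hk⟩
    have h1 := (vertexBasis s).linear_combination_coord_eq_self x
    have h2 := (vertexBasis s).sum_coord_apply_eq_one x
    rw [← Finset.sum_erase (a := k) Finset.univ (by
      change bary s k x • _ = 0
      rw [hk, zero_smul])] at h1
    rw [← Finset.sum_erase (a := k) Finset.univ hk] at h2
    rw [← h1]
    refine (convex_convexHull ℝ _).sum_mem (fun j _ => h0 j) h2 fun j hj => ?_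
    exact subset_convexHull ℝ _ ⟨j, (Finset.mem_erase.mp hj).1, rfl⟩

theorem face_subset_frontier {d : ℕ} (s : Affine.Simplex ℝ (Space d) d) (k : Fin (d + 1)) :
    face s k ⊆ frontier (openSimplex s) := by
  rw [face_eq, frontier_openSimplex]
  exact fun x hx => ⟨hx.1, k, hx.2⟩

theorem surf_frontier_openSimplex_lt_top {d : ℕ} (hd : 1 ≤ d)
    (s : Affine.Simplex ℝ (Space d) d) : surf d (frontier (openSimplex s)) < ⊤ := by
  have h : frontier (openSimplex s) ⊆ ⋃ k, face s k := by
    rw [frontier_openSimplex]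
    rintro x ⟨hx, k, hk⟩
    rw [Set.mem_iUnion]
    exact ⟨k, by rw [face_eq]; exact ⟨hx, hk⟩⟩
  refine (MeasureTheory.measure_mono h).trans_lt ?_
  refine (MeasureTheory.measure_iUnion_le _).trans_lt ?_
  rw [tsum_fintype]
  refine ENNReal.sum_lt_top.mpr fun k _ => ?_
  refine surf_lt_top_of_isBounded (bary s k) (bary_linear_ne_zero hd s k) ?_ ?_
  · exact (isBounded_closure_openSimplex s).subset
      ((face_subset_frontier s k).trans frontier_subset_closure)
  · rw [face_eq]
    exact fun x hx => hx.2

/-! ### The skeleton of a simplicial partition -/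

section Mesh

open MeasureTheory Filter Topology

variable {d : ℕ} {Ω : Set (Space d)}

/-- A point at which facet hyperplanes of the elements never cross transversally: any two of them
through `x` coincide, that is, their barycentric coordinates are proportional. -/
def Partition.Regular (T : Partition d Ω) (x : Space d) : Prop :=
  ∀ i k j l, bary (T.simplex i) k x = 0 → bary (T.simplex j) l x = 0 →
    ∃ c : ℝ, c ≠ 0 ∧ ∀ y, bary (T.simplex j) l y = c * bary (T.simplex i) k y

theorem Partition.ae_regular (hd : 1 ≤ d) (T : Partition d Ω) :
    ∀ᵐ x ∂(surf d), T.Regular x := by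
  simp only [Partition.Regular, ae_all_iff]
  intro i k j l
  by_cases h : ∃ c : ℝ, c ≠ 0 ∧ ∀ y, bary (T.simplex j) l y = c * bary (T.simplex i) k y
  · exact Eventually.of_forall fun _ _ _ => h
  · have h0 := surf_null_of_not_proportional hd _ _ (bary_linear_ne_zero hd (T.simplex i) k)
      (bary_linear_ne_zero hd (T.simplex j) l) h
    filter_upwards [measure_eq_zero_iff_ae_notMem.mp h0] with x hx h1 h2
    exact absurd ⟨h1, h2⟩ hx

theorem Partition.isOpen_elem (T : Partition d Ω) (i : Fin T.N) : IsOpen (T.elem i) :=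
  isOpen_openSimplex _

/-- A regular point of the closure of an element lies on at most one facet hyperplane of that
element, as two barycentric coordinates of one simplex are not proportional. -/
theorem Partition.Regular.bary_pos {T : Partition d Ω} {x : Space d} (hx : T.Regular x)
    {i : Fin T.N} (hi : x ∈ closure (T.elem i)) {k : Fin (d + 1)}
    (hk : bary (T.simplex i) k x = 0) {j : Fin (d + 1)} (hj : j ≠ k) :
    0 < bary (T.simplex i) j x := by
  rw [Partition.elem, closure_openSimplex] at hi
  refine lt_of_le_of_ne (hi j) fun h0 => ?_
  obtain ⟨c, -, hcy⟩ := hx i k i j hk h0.symm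
  have h1 := hcy ((T.simplex i).points j)
  rw [bary_points, bary_points, if_pos rfl, if_neg hj.symm, mul_zero] at h1
  exact one_ne_zero h1

/-- Near a regular point of its facet number `k`, an element is a half ball. -/
theorem Partition.Regular.eventually_pos {T : Partition d Ω} {x : Space d} (hx : T.Regular x)
    {i : Fin T.N} (hi : x ∈ closure (T.elem i)) {k : Fin (d + 1)}
    (hk : bary (T.simplex i) k x = 0) :
    ∀ᶠ y in 𝓝 x, ∀ j, j ≠ k → 0 < bary (T.simplex i) j y := by
  refine eventually_all.mpr fun j => ?_
  by_cases hj : j = k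
  · exact Eventually.of_forall fun _ h => absurd hj h
  · filter_upwards [(bary_continuous (T.simplex i) j).continuousAt.eventually
      (lt_mem_nhds (hx.bary_pos hi hk hj))] with y hy _ using hy

/-- At a regular point, two elements lie on opposite sides of their common facet hyperplane. -/
theorem Partition.Regular.exists_neg {T : Partition d Ω} {x : Space d} (hx : T.Regular x)
    {i j : Fin T.N} (hij : i ≠ j) (hi : x ∈ closure (T.elem i)) (hj : x ∈ closure (T.elem j))
    {k l : Fin (d + 1)} (hk : bary (T.simplex i) k x = 0) (hl : bary (T.simplex j) l x = 0) :
    ∃ c : ℝ, c < 0 ∧ ∀ y, bary (T.simplex j) l y = c * bary (T.simplex i) k y := by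
  obtain ⟨c, hc, hcy⟩ := hx i k j l hk hl
  refine ⟨c, lt_of_le_of_ne (not_lt.mp fun hpos => ?_) hc, hcy⟩
  obtain ⟨y, hyi, hy⟩ := ((mem_closure_iff_frequently.mp hi).and_eventually
    (hx.eventually_pos hj hl)).exists
  refine Set.disjoint_left.mp (T.disjoint i j hij) hyi ?_
  rw [openSimplex_eq]
  rw [Partition.elem, openSimplex_eq] at hyi
  intro n
  by_cases hn : n = l
  · rw [hn, hcy]; exact mul_pos hpos (hyi k)
  · exact hy n hn

theorem Partition.exists_bary_eq_zero (T : Partition d Ω) {i : Fin T.N} {x : Space d}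
    (hx : x ∈ frontier (T.elem i)) : ∃ k, bary (T.simplex i) k x = 0 := by
  rw [Partition.elem, frontier_openSimplex] at hx
  exact hx.2

/-- At most two elements meet at a regular point: a third one would be on the same side of the
common hyperplane as one of the others. -/
theorem Partition.Regular.eq_of_mem_frontier {T : Partition d Ω} {x : Space d}
    (hx : T.Regular x) {i j j' : Fin T.N} (hij : i ≠ j) (hij' : i ≠ j')
    (hi : x ∈ frontier (T.elem i)) (hj : x ∈ frontier (T.elem j))
    (hj' : x ∈ frontier (T.elem j')) : j = j' := by
  by_contra hne
  obtain ⟨k, hk⟩ := T.exists_bary_eq_zero hi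
  obtain ⟨l, hl⟩ := T.exists_bary_eq_zero hj
  obtain ⟨l', hl'⟩ := T.exists_bary_eq_zero hj'
  have hi := frontier_subset_closure hi
  have hj := frontier_subset_closure hj
  have hj' := frontier_subset_closure hj'
  obtain ⟨c, hc, hcy⟩ := hx.exists_neg hij hi hj hk hl
  obtain ⟨c', hc', hcy'⟩ := hx.exists_neg hij' hi hj' hk hl'
  obtain ⟨c'', hc'', hcy''⟩ := hx.exists_neg hne hj hj' hl hl'
  have h1 := hcy'' ((T.simplex i).points k)
  rw [hcy, hcy', bary_points, if_pos rfl] at h1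
  nlinarith

theorem Partition.closure_elem_subset (T : Partition d Ω) (i : Fin T.N) :
    closure (T.elem i) ⊆ closure Ω := by
  rw [← T.cover]
  exact Set.subset_iUnion (fun i => closure (openSimplex (T.simplex i))) i

theorem Partition.elem_subset (hΩ : interior (closure Ω) = Ω) (T : Partition d Ω)
    (i : Fin T.N) : T.elem i ⊆ Ω := by
  have h := interior_maximal (subset_closure.trans (T.closure_elem_subset i)) (T.isOpen_elem i)
  rwa [hΩ] at h

/-- A regular point common to two elements is interior to `Ω`: the two half balls fill a
neighbourhood of it. -/
theorem Partition.Regular.notMem_frontier {T : Partition d Ω} (hΩ : interior (closure Ω) = Ω)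
    {x : Space d} (hx : T.Regular x) {i j : Fin T.N} (hij : i ≠ j)
    (hi : x ∈ frontier (T.elem i)) (hj : x ∈ frontier (T.elem j)) : x ∉ frontier Ω := by
  obtain ⟨k, hk⟩ := T.exists_bary_eq_zero hi
  obtain ⟨l, hl⟩ := T.exists_bary_eq_zero hj
  have hi := frontier_subset_closure hi
  have hj := frontier_subset_closure hj
  obtain ⟨c, hc, hcy⟩ := hx.exists_neg hij hi hj hk hl
  have hmem : x ∈ interior (closure Ω) := by
    rw [mem_interior_iff_mem_nhds]
    filter_upwards [hx.eventually_pos hi hk, hx.eventually_pos hj hl] with y h1 h2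
    rcases le_total 0 (bary (T.simplex i) k y) with h | h
    · apply T.closure_elem_subset i
      rw [Partition.elem, closure_openSimplex]
      intro n
      by_cases hn : n = k
      · rw [hn]; exact h
      · exact (h1 n hn).le
    · apply T.closure_elem_subset j
      rw [Partition.elem, closure_openSimplex]
      intro n
      by_cases hn : n = l
      · rw [hn, hcy]; exact mul_nonneg_of_nonpos_of_nonpos hc.le h
      · exact (h2 n hn).le
  rw [← interior_interior, hΩ] at hmem
  exact fun hf => hf.2 hmem

/-- A boundary point of an element inside `Ω` belongs to another element: points of `Ω` beyond the
facet accumulate there, and finitely many elements cover them. -/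
theorem Partition.exists_neighbour (hd : 1 ≤ d) {T : Partition d Ω}
    (hΩ : interior (closure Ω) = Ω) {x : Space d} {i : Fin T.N}
    (hi : x ∈ frontier (T.elem i)) (hxΩ : x ∉ frontier Ω) :
    ∃ j, j ≠ i ∧ x ∈ frontier (T.elem j) := by
  obtain ⟨k, hk⟩ := T.exists_bary_eq_zero hi
  have hopen : IsOpen Ω := hΩ ▸ isOpen_interior
  have hmem : x ∈ Ω := by
    by_contra h
    exact hxΩ ⟨T.closure_elem_subset i (frontier_subset_closure hi), by rwa [hopen.interior_eq]⟩
  have hfreq : ∃ᶠ y in 𝓝 x, bary (T.simplex i) k y < 0 := by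
    -- Along a ray from `x` on which the coordinate decreases.
    have hv : ∃ v, (bary (T.simplex i) k).linear v < 0 := by
      obtain ⟨v, hv⟩ : ∃ v, (bary (T.simplex i) k).linear v ≠ 0 := by
        by_contra! h
        exact bary_linear_ne_zero hd (T.simplex i) k (LinearMap.ext h)
      rcases lt_or_gt_of_ne hv with h | h
      · exact ⟨v, h⟩
      · exact ⟨-v, by rw [map_neg]; linarith⟩
    obtain ⟨v, hv⟩ := hv
    have ht : Tendsto (fun t : ℝ => x + t • v) (𝓝[>] 0) (𝓝 x) := by
      have : Continuous fun t : ℝ => x + t • v := by fun_prop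
      have h := this.tendsto 0
      rw [zero_smul, add_zero] at h
      exact h.mono_left nhdsWithin_le_nhds
    refine ht.frequently (Eventually.frequently ?_)
    filter_upwards [self_mem_nhdsWithin] with t ht
    have h1 := (bary (T.simplex i) k).map_vadd x (t • v)
    rw [vadd_eq_add, vadd_eq_add, add_comm (t • v) x, hk, map_smul, add_zero, smul_eq_mul] at h1
    rw [h1]
    exact mul_neg_of_pos_of_neg ht hv
  have hex : ∃ j, ∃ᶠ y in 𝓝 x, bary (T.simplex i) k y < 0 ∧ y ∈ closure (T.elem j) := by
    by_contra! h
    obtain ⟨y, ⟨hy1, hy2⟩, hy3⟩ := ((hfreq.and_eventually (hopen.mem_nhds hmem)).and_eventually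
      (eventually_all.mpr h)).exists
    have h4 : y ∈ ⋃ j, closure (openSimplex (T.simplex j)) := by
      rw [T.cover]; exact subset_closure hy2
    obtain ⟨j, hj⟩ := Set.mem_iUnion.mp h4
    exact hy3 j hy1 hj
  obtain ⟨j, hj⟩ := hex
  have hji : j ≠ i := by
    rintro rfl
    obtain ⟨y, hy1, hy2⟩ := hj.exists
    rw [Partition.elem, closure_openSimplex] at hy2
    exact absurd (hy2 k) (not_le.mpr hy1)
  have hjc : x ∈ closure (T.elem j) := by
    have := mem_closure_iff_frequently.mpr (hj.mono fun _ h => h.2)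
    rwa [closure_closure] at this
  refine ⟨j, hji, hjc, fun hint => ?_⟩
  obtain ⟨y, hy1, hy2⟩ := ((mem_closure_iff_frequently.mp
    (frontier_subset_closure hi)).and_eventually
      ((isOpen_interior).mem_nhds hint)).exists
  exact Set.disjoint_left.mp (T.disjoint j i hji) (interior_subset hy2) hy1

/-! ### The mortars of an element tile its boundary -/

theorem Partition.carrier_subset_frontier (T : Partition d Ω) {e : T.Mortar} {i : Fin T.N}
    (h : i ∈ T.sides e) : T.carrier e ⊆ frontier (T.elem i) := by
  rcases e with e | e
  · simp only [Partition.sides, Finset.mem_insert, Finset.mem_singleton] at h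
    rcases h with rfl | rfl
    · exact Set.inter_subset_left
    · exact Set.inter_subset_right
  · simp only [Partition.sides, Finset.mem_singleton] at h
    subst h
    exact Set.inter_subset_left.trans (face_subset_frontier _ _)

theorem Partition.isClosed_carrier (T : Partition d Ω) (e : T.Mortar) :
    IsClosed (T.carrier e) := by
  rcases e with e | e
  · exact isClosed_frontier.inter isClosed_frontier
  · refine IsClosed.inter ?_ isClosed_frontier
    exact ((Set.toFinite _).isCompact_convexHull (𝕜 := ℝ)).isClosed

/-- Different mortars of the same element have no regular point in common. -/
theorem Partition.Regular.mortar_eq {T : Partition d Ω} (hΩ : interior (closure Ω) = Ω)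
    {x : Space d} (hx : T.Regular x) {i : Fin T.N} {e e' : T.Mortar}
    (he : i ∈ T.sides e) (he' : i ∈ T.sides e') (hxe : x ∈ T.carrier e)
    (hxe' : x ∈ T.carrier e') : e = e' := by
  have hi := T.carrier_subset_frontier he hxe
  rcases e with ⟨⟨q1, q2⟩, hlt, hpos⟩ | ⟨⟨q1, q2⟩, hpos⟩ <;>
  rcases e' with ⟨⟨r1, r2⟩, hlt', hpos'⟩ | ⟨⟨r1, r2⟩, hpos'⟩ <;>
  simp only [Partition.sides, Finset.mem_insert, Finset.mem_singleton] at he he' <;>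
  obtain ⟨h1, h2⟩ := hxe <;> obtain ⟨h3, h4⟩ := hxe'
  · congr 1
    apply Subtype.ext
    rcases he with rfl | rfl <;> rcases he' with h | h <;> subst h
    · have := hx.eq_of_mem_frontier hlt.ne hlt'.ne hi h2 h4
      subst this; rfl
    · have := hx.eq_of_mem_frontier hlt.ne hlt'.ne' hi h2 h3
      subst this; exact absurd hlt hlt'.asymm
    · have := hx.eq_of_mem_frontier hlt.ne' hlt'.ne hi h1 h4
      subst this; exact absurd hlt hlt'.asymm
    · have := hx.eq_of_mem_frontier hlt.ne' hlt'.ne' hi h1 h3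
      subst this; rfl
  · exact absurd h4 (hx.notMem_frontier hΩ hlt.ne h1 h2)
  · exact absurd h2 (hx.notMem_frontier hΩ hlt'.ne h3 h4)
  · subst he
    subst he'
    rw [face_eq] at h1 h3
    by_cases hq : r2 = q2
    · subst hq; rfl
    · exact absurd h3.2 (hx.bary_pos (frontier_subset_closure hi) h1.2 hq).ne'

/-- Up to a null set, the mortars of an element cover its boundary. -/
theorem Partition.ae_exists_mortar (hd : 1 ≤ d) (hΩ : interior (closure Ω) = Ω)
    (T : Partition d Ω) (i : Fin T.N) :
    ∀ᵐ x ∂(surf d), x ∈ frontier (T.elem i) → ∃ e, i ∈ T.sides e ∧ x ∈ T.carrier e := by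
  -- Points of the pairwise intersections of zero measure, which are not mortars, are discarded.
  have h1 : ∀ᵐ x ∂(surf d), ∀ q : Fin T.N × Fin T.N,
      x ∈ frontier (T.elem q.1) ∩ frontier (T.elem q.2) →
        0 < surf d (frontier (T.elem q.1) ∩ frontier (T.elem q.2)) := by
    refine ae_all_iff.mpr fun q => ?_
    by_cases h : 0 < surf d (frontier (T.elem q.1) ∩ frontier (T.elem q.2))
    · exact Eventually.of_forall fun _ _ => h
    · filter_upwards [measure_eq_zero_iff_ae_notMem.mp (nonpos_iff_eq_zero.mp (not_lt.mp h))]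
        with x hx hx'
      exact absurd hx' hx
  have h2 : ∀ᵐ x ∂(surf d), ∀ q : Fin T.N × Fin (d + 1),
      x ∈ face (T.simplex q.1) q.2 ∩ frontier Ω →
        0 < surf d (face (T.simplex q.1) q.2 ∩ frontier Ω) := by
    refine ae_all_iff.mpr fun q => ?_
    by_cases h : 0 < surf d (face (T.simplex q.1) q.2 ∩ frontier Ω)
    · exact Eventually.of_forall fun _ _ => h
    · filter_upwards [measure_eq_zero_iff_ae_notMem.mp (nonpos_iff_eq_zero.mp (not_lt.mp h))]
        with x hx hx'
      exact absurd hx' hx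
  filter_upwards [h1, h2] with x h1 h2 hx
  by_cases hxΩ : x ∈ frontier Ω
  · obtain ⟨k, hk⟩ := T.exists_bary_eq_zero hx
    have hf : x ∈ face (T.simplex i) k := by
      rw [face_eq]
      rw [Partition.elem, frontier_openSimplex] at hx
      exact ⟨hx.1, hk⟩
    exact ⟨.inr ⟨(i, k), h2 (i, k) ⟨hf, hxΩ⟩⟩, Finset.mem_singleton_self _, hf, hxΩ⟩
  · obtain ⟨j, hji, hj⟩ := T.exists_neighbour hd hΩ hx hxΩ
    rcases lt_or_gt_of_ne hji with h | h
    · exact ⟨.inl ⟨(j, i), h, h1 (j, i) ⟨hj, hx⟩⟩,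
        by simp [Partition.sides], hj, hx⟩
    · exact ⟨.inl ⟨(i, j), h, h1 (i, j) ⟨hx, hj⟩⟩,
        by simp [Partition.sides], hx, hj⟩

/-- The integral over the boundary of an element is the sum of the integrals over its mortars. -/
theorem Partition.integral_frontier_elem (hd : 1 ≤ d) (hΩ : interior (closure Ω) = Ω)
    (T : Partition d Ω) (i : Fin T.N) {h : Space d → ℝ}
    (hh : IntegrableOn h (frontier (T.elem i)) (surf d)) :
    ∫ x in frontier (T.elem i), h x ∂(surf d)
      = ∑ e : T.Mortar with i ∈ T.sides e, ∫ x in T.carrier e, h x ∂(surf d) := by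
  have hset : (frontier (T.elem i) : Set (Space d)) =ᵐ[surf d]
      ⋃ e : {e : T.Mortar // i ∈ T.sides e}, T.carrier e.1 := by
    filter_upwards [T.ae_exists_mortar hd hΩ i] with x hx
    refine propext ⟨fun h => ?_, fun h => ?_⟩
    · obtain ⟨e, he, hxe⟩ := hx h
      exact Set.mem_iUnion.mpr ⟨⟨e, he⟩, hxe⟩
    · obtain ⟨e, he⟩ := Set.mem_iUnion.mp h
      exact T.carrier_subset_frontier e.2 he
  have hdisj : Pairwise (Function.onFun (AEDisjoint (surf d))
      fun e : {e : T.Mortar // i ∈ T.sides e} => T.carrier e.1) := by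
    intro e e' hne
    refine measure_eq_zero_iff_ae_notMem.mpr ?_
    filter_upwards [T.ae_regular hd] with x hx hmem
    exact hne (Subtype.ext (hx.mortar_eq hΩ e.2 e'.2 hmem.1 hmem.2))
  rw [Measure.restrict_congr_set hset, Measure.restrict_iUnion_ae hdisj
    fun e => (T.isClosed_carrier e.1).measurableSet.nullMeasurableSet, Measure.sum_fintype,
    integral_finsetSum_measure fun e _ => hh.mono_set (T.carrier_subset_frontier e.2)]
  exact (Finset.sum_subtype _ (by simp) fun e => ∫ x in T.carrier e, h x ∂(surf d)).symm

end Mesh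

/-! ### The absolute value of a symmetric matrix -/

theorem absMat_spectral {m : ℕ} {B : Matrix (Fin m) (Fin m) ℝ} (hB : Bᵀ = B) :
    ∃ (U : Matrix (Fin m) (Fin m) ℝ) (l : Fin m → ℝ), Uᵀ * U = 1 ∧
      B = U * Matrix.diagonal l * Uᵀ ∧ absMat B = U * Matrix.diagonal (fun i => |l i|) * Uᵀ := by
  have h : B.IsHermitian := by
    rw [Matrix.IsHermitian, Matrix.conjTranspose_eq_transpose_of_trivial, hB]
  refine ⟨h.eigenvectorUnitary, h.eigenvalues, ?_, ?_, ?_⟩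
  · rw [← Matrix.conjTranspose_eq_transpose_of_trivial, ← Matrix.star_eq_conjTranspose]
    exact Unitary.coe_star_mul_self _
  · rw [← Matrix.conjTranspose_eq_transpose_of_trivial, ← Matrix.star_eq_conjTranspose]
    have h1 := h.spectral_theorem
    rw [Unitary.conjStarAlgAut_apply] at h1
    exact h1
  · rw [absMat, dif_pos h, ← Matrix.conjTranspose_eq_transpose_of_trivial,
      ← Matrix.star_eq_conjTranspose]

theorem dotProduct_conj_diagonal {m : ℕ} (U : Matrix (Fin m) (Fin m) ℝ) (l v : Fin m → ℝ) :
    v ⬝ᵥ ((U * Matrix.diagonal l * Uᵀ) *ᵥ v) = ∑ i, l i * (Uᵀ *ᵥ v) i ^ 2 := by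
  rw [← Matrix.mulVec_mulVec, ← Matrix.mulVec_mulVec, Matrix.dotProduct_mulVec,
    ← Matrix.mulVec_transpose]
  simp only [dotProduct, Matrix.mulVec_diagonal]
  exact Finset.sum_congr rfl fun i _ => by ring

theorem abs_dotProduct_mulVec_le {m : ℕ} {B : Matrix (Fin m) (Fin m) ℝ} (hB : Bᵀ = B)
    (v : Fin m → ℝ) : |v ⬝ᵥ (B *ᵥ v)| ≤ v ⬝ᵥ (absMat B *ᵥ v) := by
  obtain ⟨U, l, -, h1, h2⟩ := absMat_spectral hB
  rw [h2]
  conv_lhs => rw [h1]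
  rw [dotProduct_conj_diagonal, dotProduct_conj_diagonal]
  refine (Finset.abs_sum_le_sum_abs _ _).trans (Finset.sum_le_sum fun i _ => ?_)
  rw [abs_mul, abs_of_nonneg (sq_nonneg ((Uᵀ *ᵥ v) i))]

/-- `|B|` is definite modulo the kernel of `B`. -/
theorem mulVec_eq_zero_of_absMat {m : ℕ} {B : Matrix (Fin m) (Fin m) ℝ} (hB : Bᵀ = B)
    {v : Fin m → ℝ} (h : v ⬝ᵥ (absMat B *ᵥ v) = 0) : B *ᵥ v = 0 := by
  obtain ⟨U, l, -, h1, h2⟩ := absMat_spectral hB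
  rw [h2, dotProduct_conj_diagonal, Finset.sum_eq_zero_iff_of_nonneg
    fun i _ => mul_nonneg (abs_nonneg _) (sq_nonneg _)] at h
  have h3 : Matrix.diagonal l *ᵥ (Uᵀ *ᵥ v) = 0 := by
    ext i
    rw [Matrix.mulVec_diagonal, Pi.zero_apply]
    have := h i (Finset.mem_univ i)
    simpa using this
  rw [h1, ← Matrix.mulVec_mulVec, ← Matrix.mulVec_mulVec, h3, Matrix.mulVec_zero]

/-- The Frobenius norms of `B` and `|B|` agree row by row, as `|B|² = B²`. -/
theorem absMat_sq_le {m : ℕ} {B : Matrix (Fin m) (Fin m) ℝ} (hB : Bᵀ = B) (i j : Fin m) :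
    absMat B i j ^ 2 ≤ ∑ k, B i k ^ 2 := by
  obtain ⟨U, l, hU, h1, h2⟩ := absMat_spectral hB
  have hsymm : (absMat B)ᵀ = absMat B := by
    rw [h2]
    simp [Matrix.transpose_mul, Matrix.mul_assoc]
  have hmul : ∀ l : Fin m → ℝ, (U * Matrix.diagonal l * Uᵀ) * (U * Matrix.diagonal l * Uᵀ)
      = U * Matrix.diagonal (fun i => l i * l i) * Uᵀ := by
    intro l
    calc _ = U * Matrix.diagonal l * (Uᵀ * U) * Matrix.diagonal l * Uᵀ := by
          simp only [Matrix.mul_assoc]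
      _ = _ := by
          rw [hU, Matrix.mul_one, Matrix.mul_assoc U, Matrix.diagonal_mul_diagonal]
  have hsq : absMat B * absMat B = B * B := by
    rw [h2]
    conv_rhs => rw [h1]
    rw [hmul, hmul]
    simp
  have hrow : ∀ {C : Matrix (Fin m) (Fin m) ℝ}, Cᵀ = C → (C * C) i i = ∑ k, C i k ^ 2 := by
    intro C hC
    rw [Matrix.mul_apply]
    refine Finset.sum_congr rfl fun k _ => ?_
    rw [← Matrix.transpose_apply C, hC, sq]
  rw [← hrow hB, ← hsq, hrow hsymm]
  exact Finset.single_le_sum (f := fun k => absMat B i k ^ 2) (fun k _ => sq_nonneg _)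
    (Finset.mem_univ j)

theorem aeval_conj_diagonal {m : ℕ} {U : Matrix (Fin m) (Fin m) ℝ} (hU : Uᵀ * U = 1)
    (l : Fin m → ℝ) (q : Polynomial ℝ) :
    Polynomial.aeval (U * Matrix.diagonal l * Uᵀ) q
      = U * Matrix.diagonal (fun i => q.eval (l i)) * Uᵀ := by
  have hU' : U * Uᵀ = 1 := mul_eq_one_comm.mp hU
  induction q using Polynomial.induction_on' with
  | add p q hp hq =>
    rw [map_add, hp, hq, ← Matrix.add_mul, ← Matrix.mul_add, Matrix.diagonal_add]
    simp
  | monomial n r =>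
    have hpow : (U * Matrix.diagonal l * Uᵀ) ^ n = U * Matrix.diagonal (fun i => l i ^ n) * Uᵀ := by
      induction n with
      | zero => simp [hU']
      | succ n ih =>
        rw [pow_succ, ih]
        calc _ = U * Matrix.diagonal (fun i => l i ^ n) * (Uᵀ * U) * Matrix.diagonal l * Uᵀ := by
              simp only [Matrix.mul_assoc]
          _ = _ := by
              rw [hU, Matrix.mul_one, Matrix.mul_assoc U, Matrix.diagonal_mul_diagonal]
              simp only [pow_succ]
    rw [Polynomial.aeval_monomial, hpow, ← Algebra.smul_def, ← Matrix.smul_mul, ← Matrix.mul_smul,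
      ← Matrix.diagonal_smul]
    congr 3
    ext i
    simp

open Filter Topology in
/-- `|B|` is a limit of polynomials in `B`, the polynomials being the same for all `B`. -/
theorem exists_polynomial_tendsto_absMat :
    ∃ q : ℕ → Polynomial ℝ, ∀ (m : ℕ) (B : Matrix (Fin m) (Fin m) ℝ), Bᵀ = B →
      Tendsto (fun n => Polynomial.aeval B (q n)) atTop (𝓝 (absMat B)) := by
  have h : ∀ n : ℕ, ∃ q : Polynomial ℝ, ∀ x ∈ Set.Icc (-(n : ℝ)) n,
      abs (q.eval x - |x|) < 1 / ((n : ℝ) + 1) := fun n =>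
    exists_polynomial_near_of_continuousOn _ _ _ continuous_abs.continuousOn _
      Nat.one_div_pos_of_nat
  choose q hq using h
  refine ⟨q, fun m B hB => ?_⟩
  obtain ⟨U, l, hU, h1, h2⟩ := absMat_spectral hB
  rw [h2]
  conv => enter [1, n]; rw [h1, aeval_conj_diagonal hU]
  have hl : Tendsto (fun (n : ℕ) (i : Fin m) => (q n).eval (l i)) atTop (𝓝 fun i => |l i|) := by
    refine tendsto_pi_nhds.mpr fun i => ?_
    rw [tendsto_iff_dist_tendsto_zero]
    refine squeeze_zero' (Eventually.of_forall fun _ => dist_nonneg) ?_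
      tendsto_one_div_add_atTop_nhds_zero_nat
    obtain ⟨N, hN⟩ := exists_nat_ge |l i|
    filter_upwards [eventually_ge_atTop N] with n hn
    have h3 : |l i| ≤ (n : ℝ) := hN.trans (by exact_mod_cast hn)
    exact (hq n (l i) (abs_le.mp h3)).le
  have hc : Continuous fun v : Fin m → ℝ => U * Matrix.diagonal v * Uᵀ := by fun_prop
  exact (hc.tendsto _).comp hl

open MeasureTheory in
theorem EssBounded.absMat {d m : ℕ} {B : Space d → Matrix (Fin m) (Fin m) ℝ}
    {μ : Measure (Space d)} (hB : EssBounded B μ) (hsymm : ∀ᵐ x ∂μ, (B x)ᵀ = B x) :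
    EssBounded (fun x => absMat (B x)) μ := by
  obtain ⟨q, hq⟩ := exists_polynomial_tendsto_absMat
  have hmeas : AEStronglyMeasurable B μ := by
    have h1 : AEMeasurable (fun x i j => B x i j) μ :=
      aemeasurable_pi_iff.mpr fun i => aemeasurable_pi_iff.mpr fun j =>
        (hB i j).aestronglyMeasurable.aemeasurable
    exact h1.aestronglyMeasurable
  intro i j
  have hij : Continuous fun C : Matrix (Fin m) (Fin m) ℝ => C i j := by fun_prop
  have hm : AEStronglyMeasurable (fun x => HDG.absMat (B x) i j) μ := by
    refine aestronglyMeasurable_of_tendsto_ae Filter.atTop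
      (f := fun n x => Polynomial.aeval (B x) (q n) i j) (fun n => ?_) ?_
    · exact (hij.comp (Polynomial.continuous_aeval (q n))).comp_aestronglyMeasurable hmeas
    · filter_upwards [hsymm] with x hx
      exact (hij.tendsto _).comp (hq m (B x) hx)
  have hbd : ∀ᵐ x ∂μ, ∀ k, ‖B x i k‖ ≤ (eLpNormEssSup (fun x => B x i k) μ).toReal := by
    refine ae_all_iff.mpr fun k => ?_
    have hfin : eLpNormEssSup (fun x => B x i k) μ ≠ ⊤ := by
      have := (hB i k).eLpNorm_ne_top
      rwa [eLpNorm_exponent_top] at this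
    filter_upwards [enorm_ae_le_eLpNormEssSup (fun x => B x i k) μ] with x hx
    rw [← toReal_enorm]
    exact ENNReal.toReal_mono hfin hx
  refine memLp_top_of_bound hm
    (Real.sqrt (∑ k, (eLpNormEssSup (fun x => B x i k) μ).toReal ^ 2)) ?_
  filter_upwards [hsymm, hbd] with x hx hx'
  rw [Real.norm_eq_abs]
  refine Real.abs_le_sqrt ((absMat_sq_le hx i j).trans (Finset.sum_le_sum fun k _ => ?_))
  rw [← sq_abs]
  exact pow_le_pow_left₀ (abs_nonneg _) (hx' k) 2

/-! ### Polynomial functions -/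

open MeasureTheory

theorem contDiff_eval {d : ℕ} (q : MvPolynomial (Fin d) ℝ) :
    ContDiff ℝ ∞ fun x : Space d => MvPolynomial.eval (fun k => x k) q := by
  induction q using MvPolynomial.induction_on with
  | C r => simpa using contDiff_const
  | add p q hp hq => simpa using hp.add hq
  | mul_X p k hp =>
    have hk : ContDiff ℝ ∞ fun x : Space d => x k := by fun_prop
    simpa using hp.mul hk

theorem partialDeriv_eval {d : ℕ} (k : Fin d) (q : MvPolynomial (Fin d) ℝ) (x : Space d) :
    partialDeriv k (fun x => MvPolynomial.eval (fun k => x k) q) x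
      = MvPolynomial.eval (fun k => x k) (MvPolynomial.pderiv k q) := by
  have hdiff : ∀ q : MvPolynomial (Fin d) ℝ, DifferentiableAt ℝ
      (fun x : Space d => MvPolynomial.eval (fun k => x k) q) x := fun q =>
    (contDiff_eval q).differentiable (by simp) x
  rw [partialDeriv]
  induction q using MvPolynomial.induction_on with
  | C r => simp
  | add p q hp hq =>
    simp only [map_add]
    rw [fderiv_fun_add (hdiff p) (hdiff q), add_apply, hp, hq]
  | mul_X p j hp =>
    have hX : HasFDerivAt (fun x : Space d => x j)
        (EuclideanSpace.proj (𝕜 := ℝ) j : Space d →L[ℝ] ℝ) x :=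
      (EuclideanSpace.proj (𝕜 := ℝ) j : Space d →L[ℝ] ℝ).hasFDerivAt
    simp only [map_mul, MvPolynomial.eval_X]
    rw [fderiv_fun_mul (hdiff p) hX.differentiableAt, hX.fderiv, add_apply,
      smul_apply, smul_apply, hp, Derivation.leibniz]
    by_cases hjk : j = k
    · subst hjk
      simp [MvPolynomial.pderiv_X]
    · simp [MvPolynomial.pderiv_X, hjk]

theorem continuous_polyEval {d m : ℕ} (q : Fin m → MvPolynomial (Fin d) ℝ) :
    Continuous (polyEval q) :=
  continuous_pi fun i => (contDiff_eval (q i)).continuous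

theorem memLp_of_continuous {d : ℕ} {F : Type*} [NormedAddCommGroup F] {f : Space d → F}
    (hf : Continuous f) [SecondCountableTopologyEither (Space d) F]
    {μ : Measure (Space d)} {s : Set (Space d)} (hs : MeasurableSet s)
    (hb : Bornology.IsBounded s) (hfin : μ s < ⊤) (p : ℝ≥0∞) : MemLp f p (μ.restrict s) := by
  have : IsFiniteMeasure (μ.restrict s) := ⟨by rwa [Measure.restrict_apply_univ]⟩
  obtain ⟨C, hC⟩ := hb.isCompact_closure.exists_bound_of_continuousOn hf.continuousOn
  exact MemLp.of_bound hf.aestronglyMeasurable C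
    ((ae_restrict_mem hs).mono fun x hx => hC x (subset_closure hx))

/-- A polynomial vanishing on an open set, hence on a box, is zero. -/
theorem eq_zero_of_ae_eval_eq_zero {d : ℕ} {U : Set (Space d)} (hU : IsOpen U)
    (hne : U.Nonempty) {q : MvPolynomial (Fin d) ℝ}
    (h : ∀ᵐ x ∂(volume.restrict U), MvPolynomial.eval (fun k => x k) q = 0) : q = 0 := by
  have heq : Set.EqOn (fun x : Space d => MvPolynomial.eval (fun k => x k) q) (fun _ => 0) U :=
    Measure.eqOn_open_of_ae_eq h hU (contDiff_eval q).continuous.continuousOn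
      continuousOn_const
  obtain ⟨c, hc⟩ := hne
  have hV : IsOpen ((WithLp.toLp 2 : (Fin d → ℝ) → Space d) ⁻¹' U) :=
    hU.preimage (PiLp.continuous_toLp 2 _)
  obtain ⟨ε, hε, hball⟩ := Metric.isOpen_iff.mp hV (fun k => c k) hc
  refine MvPolynomial.funext_set (fun k => Metric.ball (c k) ε) (fun k => ?_) fun x hx => ?_
  · rw [Real.ball_eq_Ioo]
    exact Set.Ioo_infinite (by linarith)
  · rw [← ball_pi _ hε] at hx
    simpa using heq (hball hx)

/-! ### Bilinear forms with bounded coefficients -/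

theorem EssBounded.mono {d m : ℕ} {B : Space d → Matrix (Fin m) (Fin m) ℝ}
    {μ ν : Measure (Space d)} (hB : EssBounded B ν) (h : μ ≤ ν) : EssBounded B μ :=
  fun i j => (hB i j).mono_measure h

theorem EssBounded.add {d m : ℕ} {B C : Space d → Matrix (Fin m) (Fin m) ℝ}
    {μ : Measure (Space d)} (hB : EssBounded B μ) (hC : EssBounded C μ) :
    EssBounded (fun x => B x + C x) μ :=
  fun i j => (hB i j).add (hC i j)

theorem EssBounded.sub {d m : ℕ} {B C : Space d → Matrix (Fin m) (Fin m) ℝ}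
    {μ : Measure (Space d)} (hB : EssBounded B μ) (hC : EssBounded C μ) :
    EssBounded (fun x => B x - C x) μ :=
  fun i j => (hB i j).sub (hC i j)

theorem EssBounded.const_smul {d m : ℕ} {B : Space d → Matrix (Fin m) (Fin m) ℝ}
    {μ : Measure (Space d)} (hB : EssBounded B μ) (c : ℝ) :
    EssBounded (fun x => c • B x) μ :=
  fun i j => (hB i j).const_smul c

theorem EssBounded.integrable {d m : ℕ} {B : Space d → Matrix (Fin m) (Fin m) ℝ}
    {μ : Measure (Space d)} (hB : EssBounded B μ) {u v : Space d → Fin m → ℝ}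
    (hu : MemLp u 2 μ) (hv : MemLp v 2 μ) :
    Integrable (fun x => (B x *ᵥ u x) ⬝ᵥ v x) μ := by
  have h : ∀ i j, Integrable (fun x => B x i j * u x j * v x i) μ := by
    intro i j
    have h1 : MemLp (fun x => B x i j * u x j) 2 μ :=
      MemLp.mul (p := ⊤) (q := 2) (memLp_pi_iff.mp hu j) (hB i j)
    exact h1.integrable_mul (memLp_pi_iff.mp hv i)
  simp only [dotProduct, Matrix.mulVec, Finset.sum_mul]
  exact integrable_finsetSum _ fun i _ => integrable_finsetSum _ fun j _ => h i j

open Classical in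
/-- The bilinear form `(u, v) ↦ ∫ (B u) ⬝ v dμ` on `L²(μ)^m` of an essentially bounded matrix
field `B` (and zero if `B` is not essentially bounded). -/
noncomputable def coeffForm {d m : ℕ} (μ : Measure (Space d))
    (B : Space d → Matrix (Fin m) (Fin m) ℝ) :
    Lp (Fin m → ℝ) 2 μ →ₗ[ℝ] Lp (Fin m → ℝ) 2 μ →ₗ[ℝ] ℝ :=
  if hB : EssBounded B μ then
    LinearMap.mk₂ ℝ (fun u v => ∫ x, (B x *ᵥ u x) ⬝ᵥ v x ∂μ)
      (fun u u' v => by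
        rw [← integral_add (hB.integrable (Lp.memLp u) (Lp.memLp v))
          (hB.integrable (Lp.memLp u') (Lp.memLp v))]
        refine integral_congr_ae ?_
        filter_upwards [Lp.coeFn_add u u'] with x hx
        rw [hx, Pi.add_apply, Matrix.mulVec_add, add_dotProduct])
      (fun c u v => by
        rw [smul_eq_mul, ← integral_const_mul]
        refine integral_congr_ae ?_
        filter_upwards [Lp.coeFn_smul c u] with x hx
        rw [hx, Pi.smul_apply, Matrix.mulVec_smul, smul_dotProduct, smul_eq_mul])
      (fun u v v' => by
        rw [← integral_add (hB.integrable (Lp.memLp u) (Lp.memLp v))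
          (hB.integrable (Lp.memLp u) (Lp.memLp v'))]
        refine integral_congr_ae ?_
        filter_upwards [Lp.coeFn_add v v'] with x hx
        rw [hx, Pi.add_apply, dotProduct_add])
      (fun c u v => by
        rw [smul_eq_mul, ← integral_const_mul]
        refine integral_congr_ae ?_
        filter_upwards [Lp.coeFn_smul c v] with x hx
        rw [hx, Pi.smul_apply, dotProduct_smul, smul_eq_mul])
  else 0

theorem EssBounded.coeffForm_apply {d m : ℕ} {μ : Measure (Space d)}
    {B : Space d → Matrix (Fin m) (Fin m) ℝ} (hB : EssBounded B μ)
    {u v : Lp (Fin m → ℝ) 2 μ} {u' v' : Space d → Fin m → ℝ}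
    (hu : u =ᵐ[μ] u') (hv : v =ᵐ[μ] v') :
    coeffForm μ B u v = ∫ x, (B x *ᵥ u' x) ⬝ᵥ v' x ∂μ := by
  rw [coeffForm, dif_pos hB, LinearMap.mk₂_apply]
  refine integral_congr_ae ?_
  filter_upwards [hu, hv] with x h1 h2
  rw [h1, h2]

open Classical in
/-- Vector-valued polynomials as elements of `L²(μ)^m`, when all of them are square integrable (and
zero otherwise). -/
noncomputable def polyLp {d : ℕ} (m : ℕ) (μ : Measure (Space d)) :
    (Fin m → MvPolynomial (Fin d) ℝ) →ₗ[ℝ] Lp (Fin m → ℝ) 2 μ :=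
  if h : ∀ q : Fin m → MvPolynomial (Fin d) ℝ, MemLp (polyEval q) 2 μ then
    { toFun := fun q => (h q).toLp _
      map_add' := fun q r => by
        rw [← MemLp.toLp_add]
        congr 1
        ext x i
        simp [polyEval]
      map_smul' := fun c q => by
        rw [RingHom.id_apply, ← MemLp.toLp_const_smul]
        congr 1
        ext x i
        simp [polyEval] }
  else 0

theorem coeFn_polyLp {d m : ℕ} {μ : Measure (Space d)}
    (h : ∀ q : Fin m → MvPolynomial (Fin d) ℝ, MemLp (polyEval q) 2 μ)
    (q : Fin m → MvPolynomial (Fin d) ℝ) : polyLp m μ q =ᵐ[μ] polyEval q := by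
  rw [polyLp, dif_pos h]
  exact (h q).coeFn_toLp

/-- Polynomials of degree at most `p` inside all polynomials. -/
noncomputable def VecPoly.toPoly {d m p : ℕ} :
    VecPoly d m p →ₗ[ℝ] Fin m → MvPolynomial (Fin d) ℝ :=
  LinearMap.pi fun i => (Submodule.subtype _).comp (LinearMap.proj i)

theorem polyTrace_eq_map {d m p : ℕ} {e : Set (Space d)}
    (h : ∀ q : Fin m → MvPolynomial (Fin d) ℝ, MemLp (polyEval q) 2 ((surf d).restrict e)) :
    polyTrace m p e
      = LinearMap.range ((polyLp m ((surf d).restrict e)).comp (VecPoly.toPoly (p := p))) := by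
  ext f
  constructor
  · rintro ⟨q, hq⟩
    exact ⟨q, Lp.ext ((coeFn_polyLp h _).trans hq.symm)⟩
  · rintro ⟨q, rfl⟩
    exact ⟨q, coeFn_polyLp h _⟩

/-! ### Symmetry of the divergence and of the normal traces -/

section Trace

variable {d m : ℕ} {Ω : Set (Space d)} {A : Fin d → Space d → Matrix (Fin m) (Fin m) ℝ}
  {D G : Space d → Matrix (Fin m) (Fin m) ℝ}

theorem EssBounded.integrable_mul_test {B : Space d → Matrix (Fin m) (Fin m) ℝ}
    {μ : Measure (Space d)} (hB : EssBounded B μ) {φ : Space d → ℝ} (hφ : Integrable φ μ)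
    (i j : Fin m) : Integrable (fun x => B x i j * φ x) μ := by
  have h1 : MemLp (fun x => B x i j * φ x) 1 μ :=
    MemLp.mul (p := ⊤) (q := 1) (memLp_one_iff_integrable.mpr hφ) (hB i j)
  exact memLp_one_iff_integrable.mp h1

theorem IsOneFieldFriedrichs.integral_A_symm (hsys : IsOneFieldFriedrichs Ω A D G)
    {K : Set (Space d)} (hK : K ⊆ Ω) (ψ : Fin d → Space d → ℝ) (i j : Fin m) :
    (∑ k, ∫ x in K, A k x i j * ψ k x) = ∑ k, ∫ x in K, A k x j i * ψ k x := by
  refine Finset.sum_congr rfl fun k _ => integral_congr_ae ?_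
  filter_upwards [ae_restrict_of_ae_restrict_of_subset hK (hsys.A_symm k)] with x hx
  conv_lhs => rw [← hx, Matrix.transpose_apply]

/-- The weak divergence of symmetric fields is symmetric. -/
theorem IsOneFieldFriedrichs.D_symm (hsys : IsOneFieldFriedrichs Ω A D G) (hΩ : IsOpen Ω) :
    ∀ᵐ x ∂(volume.restrict Ω), (D x)ᵀ = D x := by
  have h : ∀ i j, ∀ᵐ x ∂(volume.restrict Ω), D x j i - D x i j = 0 := by
    intro i j
    have h0 : ∀ᵐ x ∂(volume.restrict Ω), x ∈ Ω → D x j i - D x i j = 0 := by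
      refine hΩ.ae_eq_zero_of_integral_contDiff_smul_eq_zero ?_ fun φ h1 h2 h3 => ?_
      · exact (((hsys.D_bounded j i).sub (hsys.D_bounded i j)).locallyIntegrable
          le_top).locallyIntegrableOn Ω
      · have hφ : Integrable φ (volume.restrict Ω) :=
          (h1.continuous.integrable_of_hasCompactSupport h2).restrict
        have e1 := hsys.div_A φ h1 h2 h3 j i
        have e2 := hsys.div_A φ h1 h2 h3 i j
        rw [hsys.integral_A_symm subset_rfl] at e1
        have e3 := neg_injective (e1.symm.trans e2)
        simp only [smul_eq_mul, mul_comm (φ _), sub_mul]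
        rw [integral_sub (hsys.D_bounded.integrable_mul_test hφ j i)
          (hsys.D_bounded.integrable_mul_test hφ i j), e3, sub_self]
    filter_upwards [h0, ae_restrict_mem hΩ.measurableSet] with x hx hx' using hx hx'
  filter_upwards [ae_all_iff.mpr fun i => ae_all_iff.mpr (h i)] with x hx
  ext i j
  exact sub_eq_zero.mp (hx i j)

/-- Normal traces of symmetric fields are symmetric, so that `absMat` is their absolute value. -/
theorem IsNormalTrace.symm (hsys : IsOneFieldFriedrichs Ω A D G) (hΩ : IsOpen Ω)
    {K : Set (Space d)} (hK : K ⊆ Ω) (hfin : surf d (frontier K) < ⊤)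
    {a : Space d → Matrix (Fin m) (Fin m) ℝ} (ha : IsNormalTrace K A D a) :
    ∀ᵐ x ∂((surf d).restrict (frontier K)), (a x)ᵀ = a x := by
  have : IsFiniteMeasure ((surf d).restrict (frontier K)) :=
    ⟨by rwa [Measure.restrict_apply_univ]⟩
  have h : ∀ i j, ∀ᵐ x ∂((surf d).restrict (frontier K)), a x j i - a x i j = 0 := by
    intro i j
    refine ae_eq_zero_of_integral_contDiff_smul_eq_zero ?_ fun φ h1 h2 => ?_
    · exact ((ha.bounded j i).sub (ha.bounded i j)).locallyIntegrable le_top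
    · have hφ : Integrable φ ((surf d).restrict (frontier K)) :=
        h1.continuous.integrable_of_hasCompactSupport h2
      have e1 := ha.green φ h1 h2 j i
      have e2 := ha.green φ h1 h2 i j
      have e3 : ∫ x in K, D x j i * φ x = ∫ x in K, D x i j * φ x := by
        refine integral_congr_ae ?_
        filter_upwards [ae_restrict_of_ae_restrict_of_subset hK (hsys.D_symm hΩ)] with x hx
        conv_lhs => rw [← hx, Matrix.transpose_apply]
      rw [hsys.integral_A_symm hK, e3, e2] at e1
      simp only [smul_eq_mul, mul_comm (φ _), sub_mul]
      rw [integral_sub (ha.bounded.integrable_mul_test hφ j i)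
        (ha.bounded.integrable_mul_test hφ i j), e1, sub_self]
  filter_upwards [ae_all_iff.mpr fun i => ae_all_iff.mpr (h i)] with x hx
  ext i j
  exact sub_eq_zero.mp (hx i j)

/-! ### Integration by parts for polynomials -/

/-- The Green identity of a normal trace extends to polynomials, by a cut-off function equal to one
near the bounded set `K`. -/
theorem IsNormalTrace.green_eval {K : Set (Space d)} (hKo : IsOpen K)
    (hKb : Bornology.IsBounded (closure K)) {a : Space d → Matrix (Fin m) (Fin m) ℝ}
    (ha : IsNormalTrace K A D a) (q : MvPolynomial (Fin d) ℝ) (i j : Fin m) :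
    (∑ k, ∫ x in K, A k x i j * MvPolynomial.eval (fun k => x k) (MvPolynomial.pderiv k q))
      + (∫ x in K, D x i j * MvPolynomial.eval (fun k => x k) q)
      = ∫ x in frontier K, a x i j * MvPolynomial.eval (fun k => x k) q ∂(surf d) := by
  obtain ⟨R, hR⟩ := (Metric.isBounded_iff_subset_closedBall 0).mp hKb
  let χ : ContDiffBump (0 : Space d) :=
    { rIn := max R 1, rOut := max R 1 + 1, rIn_pos := by positivity, rIn_lt_rOut := by linarith }
  have hχ : ∀ x ∈ closure K, χ x = 1 := fun x hx =>
    χ.one_of_mem_closedBall (Metric.closedBall_subset_closedBall (le_max_left _ _) (hR hx))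
  set P : Space d → ℝ := fun x => MvPolynomial.eval (fun k => x k) q with hP
  have h := ha.green (fun x => χ x * P x) (χ.contDiff.mul (contDiff_eval q))
    (χ.hasCompactSupport.mul_right) i j
  have e1 : ∀ k, ∫ x in K, A k x i j * partialDeriv k (fun x => χ x * P x) x
      = ∫ x in K, A k x i j * MvPolynomial.eval (fun k => x k) (MvPolynomial.pderiv k q) := by
    intro k
    refine setIntegral_congr_fun hKo.measurableSet fun x hx => ?_
    have hev : (fun x => χ x * P x) =ᶠ[nhds x] P := by
      filter_upwards [hKo.mem_nhds hx] with y hy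
      rw [hχ y (subset_closure hy), one_mul]
    change A k x i j * partialDeriv k (fun x => χ x * P x) x = _
    rw [partialDeriv, hev.fderiv_eq, ← partialDeriv_eval, partialDeriv]
  have e2 : ∫ x in K, D x i j * (χ x * P x) = ∫ x in K, D x i j * P x :=
    setIntegral_congr_fun hKo.measurableSet fun x hx => by
      rw [hχ x (subset_closure hx), one_mul]
  have e3 : ∫ x in frontier K, a x i j * (χ x * P x) ∂(surf d)
      = ∫ x in frontier K, a x i j * P x ∂(surf d) :=
    setIntegral_congr_fun isClosed_frontier.measurableSet fun x hx => by
      rw [hχ x (frontier_subset_closure hx), one_mul]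
  rw [e2, e3, Finset.sum_congr rfl fun k _ => e1 k] at h
  exact h

theorem integral_mulVec_dotProduct {μ : Measure (Space d)}
    {B : Space d → Matrix (Fin m) (Fin m) ℝ} (hB : EssBounded B μ) {u v : Space d → Fin m → ℝ}
    (hu : MemLp u 2 μ) (hv : MemLp v 2 μ) :
    ∫ x, (B x *ᵥ u x) ⬝ᵥ v x ∂μ = ∑ i, ∑ j, ∫ x, B x i j * (v x i * u x j) ∂μ := by
  have h : ∀ i j, Integrable (fun x => B x i j * (v x i * u x j)) μ := fun i j =>
    hB.integrable_mul_test ((memLp_pi_iff.mp hv i).integrable_mul (memLp_pi_iff.mp hu j)) i j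
  rw [← Finset.sum_congr rfl fun i _ => integral_finsetSum _ fun j _ => h i j,
    ← integral_finsetSum _ fun i _ => integrable_finsetSum _ fun j _ => h i j]
  refine integral_congr_ae (Filter.Eventually.of_forall fun x => ?_)
  simp only [dotProduct, Matrix.mulVec, Finset.sum_mul]
  exact Finset.sum_congr rfl fun i _ => Finset.sum_congr rfl fun j _ => by ring

/-- Integration by parts in the advection term: as the `A_k` are symmetric, it is half of the
divergence of `∑_k (A_k z) ⬝ z`, up to the term with `∑_k ∂_k A_k`. -/
theorem IsNormalTrace.two_mul_advection (hsys : IsOneFieldFriedrichs Ω A D G)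
    {K : Set (Space d)} (hK : K ⊆ Ω) (hKo : IsOpen K)
    (hKb : Bornology.IsBounded (closure K)) (hfin : surf d (frontier K) < ⊤)
    {a : Space d → Matrix (Fin m) (Fin m) ℝ}
    (ha : IsNormalTrace K A D a) (z : Fin m → MvPolynomial (Fin d) ℝ) :
    2 * (∑ k, ∫ x in K, (A k x *ᵥ polyEval z x)
        ⬝ᵥ polyEval (fun i => MvPolynomial.pderiv k (z i)) x)
      = (∫ x in frontier K, (a x *ᵥ polyEval z x) ⬝ᵥ polyEval z x ∂(surf d))
        - ∫ x in K, (D x *ᵥ polyEval z x) ⬝ᵥ polyEval z x := by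
  have hKvol : volume K < ⊤ := (hKb.subset subset_closure).measure_lt_top
  have hKL : ∀ q : Fin m → MvPolynomial (Fin d) ℝ, MemLp (polyEval q) 2 (volume.restrict K) :=
    fun q => memLp_of_continuous (continuous_polyEval q) hKo.measurableSet
      (hKb.subset subset_closure) hKvol 2
  have hFL : MemLp (polyEval z) 2 ((surf d).restrict (frontier K)) :=
    memLp_of_continuous (continuous_polyEval z) isClosed_frontier.measurableSet
      (hKb.subset frontier_subset_closure) hfin 2
  have hle : volume.restrict K ≤ volume.restrict Ω := Measure.restrict_mono hK le_rfl
  rw [integral_mulVec_dotProduct ha.bounded hFL hFL,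
    integral_mulVec_dotProduct (hsys.D_bounded.mono hle) (hKL z) (hKL z)]
  have hG : ∀ i j, _ := fun i j => ha.green_eval hKo hKb (z i * z j) i j
  simp only [MvPolynomial.eval_mul] at hG
  change _ = (∑ i, ∑ j, ∫ x in frontier K, a x i j *
    (MvPolynomial.eval (fun k => x k) (z i) * MvPolynomial.eval (fun k => x k) (z j)) ∂(surf d))
    - (∑ i, ∑ j, ∫ x in K, D x i j *
    (MvPolynomial.eval (fun k => x k) (z i) * MvPolynomial.eval (fun k => x k) (z j)))
  simp only [← hG, ← Finset.sum_sub_distrib, add_sub_cancel_right]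
  rw [Finset.mul_sum, Finset.sum_congr rfl fun i _ => Finset.sum_comm, Finset.sum_comm]
  refine Finset.sum_congr rfl fun k _ => ?_
  have hint : ∀ i j, Integrable (fun x : Space d => A k x i j * MvPolynomial.eval (fun k => x k)
      (MvPolynomial.pderiv k (z i * z j))) (volume.restrict K) := fun i j =>
    ((hsys.A_bounded k).mono hle).integrable_mul_test (memLp_one_iff_integrable.mp
      (memLp_of_continuous (contDiff_eval _).continuous hKo.measurableSet
        (hKb.subset subset_closure) hKvol 1)) i j
  rw [← Finset.sum_congr rfl fun i _ => integral_finsetSum _ fun j _ => hint i j,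
    ← integral_finsetSum _ fun i _ => integrable_finsetSum _ fun j _ => hint i j,
    ← integral_const_mul]
  refine integral_congr_ae ?_
  filter_upwards [ae_restrict_of_ae_restrict_of_subset hK (hsys.A_symm k)] with x hx
  simp only [Derivation.leibniz, smul_eq_mul, map_add, map_mul, mul_add, Finset.sum_add_distrib]
  have e1 : ∑ i, ∑ j, A k x i j * (MvPolynomial.eval (fun k => x k) (z j)
      * MvPolynomial.eval (fun k => x k) (MvPolynomial.pderiv k (z i)))
      = (A k x *ᵥ polyEval z x) ⬝ᵥ polyEval (fun i => MvPolynomial.pderiv k (z i)) x := by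
    simp only [dotProduct, Matrix.mulVec, Finset.sum_mul, polyEval, mul_assoc]
  have e2 : ∑ i, ∑ j, A k x i j * (MvPolynomial.eval (fun k => x k) (z i)
      * MvPolynomial.eval (fun k => x k) (MvPolynomial.pderiv k (z j)))
      = (A k x *ᵥ polyEval z x) ⬝ᵥ polyEval (fun i => MvPolynomial.pderiv k (z i)) x := by
    rw [← e1, Finset.sum_comm]
    refine Finset.sum_congr rfl fun i _ => Finset.sum_congr rfl fun j _ => ?_
    rw [← Matrix.transpose_apply (A k x), hx]
  rw [e1, e2]
  ring

end Trace

/-! ### The energy identity -/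

section Energy

variable {d m : ℕ} {Ω : Set (Space d)} {A : Fin d → Space d → Matrix (Fin m) (Fin m) ℝ}
  {D G : Space d → Matrix (Fin m) (Fin m) ℝ}

theorem Partition.memLp_elem (T : Partition d Ω) (i : Fin T.N)
    (q : Fin m → MvPolynomial (Fin d) ℝ) :
    MemLp (polyEval q) 2 (volume.restrict (T.elem i)) :=
  have hb := (isBounded_closure_openSimplex (T.simplex i)).subset subset_closure
  memLp_of_continuous (continuous_polyEval q) (T.isOpen_elem i).measurableSet hb
    hb.measure_lt_top 2

theorem Partition.memLp_frontier (hd : 1 ≤ d) (T : Partition d Ω) (i : Fin T.N)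
    (q : Fin m → MvPolynomial (Fin d) ℝ) :
    MemLp (polyEval q) 2 ((surf d).restrict (frontier (T.elem i))) :=
  memLp_of_continuous (continuous_polyEval q) isClosed_frontier.measurableSet
    ((isBounded_closure_openSimplex (T.simplex i)).subset frontier_subset_closure)
    (surf_frontier_openSimplex_lt_top hd _) 2

theorem Partition.sides_nonempty (T : Partition d Ω) (e : T.Mortar) : (T.sides e).Nonempty := by
  rcases e with e | e
  · exact Finset.insert_nonempty _ _
  · exact Finset.singleton_nonempty _

theorem Partition.restrict_carrier_le (T : Partition d Ω) {e : T.Mortar} {i : Fin T.N}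
    (h : i ∈ T.sides e) :
    (surf d).restrict (T.carrier e) ≤ (surf d).restrict (frontier (T.elem i)) :=
  Measure.restrict_mono (T.carrier_subset_frontier h) le_rfl

theorem Partition.memLp_carrier (hd : 1 ≤ d) (T : Partition d Ω) (e : T.Mortar)
    (q : Fin m → MvPolynomial (Fin d) ℝ) :
    MemLp (polyEval q) 2 ((surf d).restrict (T.carrier e)) := by
  obtain ⟨i, hi⟩ := T.sides_nonempty e
  exact (T.memLp_frontier hd i q).mono_measure (T.restrict_carrier_le hi)

theorem Partition.restrict_boundary_carrier_le (T : Partition d Ω) (b : T.BdMortar) :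
    (surf d).restrict (T.carrier (.inr b)) ≤ (surf d).restrict (frontier Ω) :=
  Measure.restrict_mono Set.inter_subset_right le_rfl

/-- The energy of the upwind flux at a point: with `δ = u - v`, it is a nonnegative form in `δ`
up to a term in `v` that telescopes across the mortars. -/
theorem flux_energy {B : Matrix (Fin m) (Fin m) ℝ} (hB : Bᵀ = B) (u v : Fin m → ℝ) :
    (B *ᵥ u + absMat B *ᵥ (u - v)) ⬝ᵥ u - (B *ᵥ u + absMat B *ᵥ (u - v)) ⬝ᵥ v
        - 1 / 2 * ((B *ᵥ u) ⬝ᵥ u)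
      = (((1 / 2 : ℝ) • B + absMat B) *ᵥ (u - v)) ⬝ᵥ (u - v) - 1 / 2 * ((B *ᵥ v) ⬝ᵥ v) := by
  have hsw : (B *ᵥ v) ⬝ᵥ u = (B *ᵥ u) ⬝ᵥ v := by
    rw [dotProduct_comm, Matrix.dotProduct_mulVec, ← Matrix.mulVec_transpose, hB]
  simp only [Matrix.add_mulVec, Matrix.smul_mulVec, Matrix.mulVec_sub, add_dotProduct,
    sub_dotProduct, dotProduct_sub, smul_dotProduct, smul_eq_mul, hsw]
  ring

/-- Half of `|B|` compensates a possibly negative `½ B`. -/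
theorem half_absMat_le {B : Matrix (Fin m) (Fin m) ℝ} (hB : Bᵀ = B) (v : Fin m → ℝ) :
    1 / 2 * (v ⬝ᵥ (absMat B *ᵥ v)) ≤ (((1 / 2 : ℝ) • B + absMat B) *ᵥ v) ⬝ᵥ v := by
  have h := (abs_le.mp (abs_dotProduct_mulVec_le hB v)).1
  rw [dotProduct_comm _ v, Matrix.add_mulVec, Matrix.smul_mulVec, dotProduct_add,
    dotProduct_smul, smul_eq_mul]
  linarith

/-- The volume terms left after integration by parts control the `L²` norm. -/
theorem IsOneFieldFriedrichs.coercive_integral (hsys : IsOneFieldFriedrichs Ω A D G) :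
    ∃ μ₀ : ℝ, 0 < μ₀ ∧ ∀ K : Set (Space d), K ⊆ Ω → ∀ u : Space d → Fin m → ℝ,
      MemLp u 2 (volume.restrict K) →
      μ₀ * (∫ x in K, u x ⬝ᵥ u x) ≤ (∫ x in K, (G x *ᵥ u x) ⬝ᵥ u x)
        + 1 / 2 * ∫ x in K, (D x *ᵥ u x) ⬝ᵥ u x := by
  obtain ⟨μ₀, hμ, h⟩ := hsys.coercive
  refine ⟨μ₀, hμ, fun K hK u hu => ?_⟩
  have hle : volume.restrict K ≤ volume.restrict Ω := Measure.restrict_mono hK le_rfl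
  have hG := (hsys.G_bounded.mono hle).integrable hu hu
  have hD := (hsys.D_bounded.mono hle).integrable hu hu
  have hu2 : Integrable (fun x => u x ⬝ᵥ u x) (volume.restrict K) := by
    simp only [dotProduct]
    exact integrable_finsetSum _ fun i _ =>
      (memLp_pi_iff.mp hu i).integrable_mul (memLp_pi_iff.mp hu i)
  rw [← integral_const_mul, ← integral_const_mul, ← integral_add hG (hD.const_mul _)]
  refine integral_mono_ae (hu2.const_mul _) (hG.add (hD.const_mul _)) ?_
  filter_upwards [ae_restrict_of_ae_restrict_of_subset hK h] with x hx
  have h1 := hx (u x)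
  have h2 : u x ⬝ᵥ ((G x)ᵀ *ᵥ u x) = u x ⬝ᵥ (G x *ᵥ u x) := by
    rw [Matrix.mulVec_transpose, dotProduct_comm, ← Matrix.dotProduct_mulVec]
  simp only [Matrix.add_mulVec, Matrix.sub_mulVec, Matrix.smul_mulVec, Matrix.one_mulVec,
    dotProduct_add, dotProduct_sub, dotProduct_smul, smul_eq_mul, h2] at h1
  rw [dotProduct_comm (G x *ᵥ u x), dotProduct_comm (D x *ᵥ u x)]
  linarith

theorem Partition.integrable_flux (hd : 1 ≤ d) (T : Partition d Ω) {p : Fin T.N → ℕ}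
    {a : Fin T.N → Space d → Matrix (Fin m) (Fin m) ℝ}
    (ha : ∀ i, EssBounded (a i) ((surf d).restrict (frontier (T.elem i))))
    (habs : ∀ i, EssBounded (fun x => absMat (a i x)) ((surf d).restrict (frontier (T.elem i))))
    {i : Fin T.N} {e : T.Mortar} (hi : i ∈ T.sides e)
    (z : T.VolSpace m p) (zh : T.TraceSpace m p) {v : Space d → Fin m → ℝ}
    (hv : MemLp v 2 ((surf d).restrict (T.carrier e))) :
    Integrable (fun x => T.flux a z zh i e x ⬝ᵥ v x) ((surf d).restrict (T.carrier e)) := by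
  have hz : MemLp (z i).val 2 ((surf d).restrict (T.carrier e)) := T.memLp_carrier hd e _
  have h1 := ((ha i).mono (T.restrict_carrier_le hi)).integrable hz hv
  have h2 := ((habs i).mono (T.restrict_carrier_le hi)).integrable (hz.sub (Lp.memLp (zh e).1)) hv
  refine (h1.add h2).congr (Filter.Eventually.of_forall fun x => ?_)
  simp only [Partition.flux, add_dotProduct, Pi.add_apply, Pi.sub_apply]

/-- Summing the homogeneous local equations tested with `z` and the homogeneous global equations
tested with `ẑ` leaves a sum of nonnegative terms. -/
theorem Partition.energy_identity (hd : 1 ≤ d) (hΩ : interior (closure Ω) = Ω)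
    (T : Partition d Ω) {p : Fin T.N → ℕ} (hsys : IsOneFieldFriedrichs Ω A D G)
    {a : Fin T.N → Space d → Matrix (Fin m) (Fin m) ℝ}
    (ha : ∀ i, IsNormalTrace (T.elem i) A D (a i))
    (ha_symm : ∀ i, ∀ᵐ x ∂((surf d).restrict (frontier (T.elem i))), (a i x)ᵀ = a i x)
    (ha_cont : ∀ i j, i ≠ j →
      ∀ᵐ x ∂((surf d).restrict (frontier (T.elem i) ∩ frontier (T.elem j))), a i x = - a j x)
    {M : Space d → Matrix (Fin m) (Fin m) ℝ}
    (hM : EssBounded M ((surf d).restrict (frontier Ω)))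
    {z : T.VolSpace m p} {zh : T.TraceSpace m p}
    (hloc : T.LocalEq A G a 0 z zh) (hglob : T.GlobalEq a M 0 z zh) :
    (∑ i, ((∫ x in T.elem i, (G x *ᵥ (z i).val x) ⬝ᵥ (z i).val x)
          + 1 / 2 * ∫ x in T.elem i, (D x *ᵥ (z i).val x) ⬝ᵥ (z i).val x))
      + (∑ e : T.Mortar, ∑ i ∈ T.sides e, ∫ x in T.carrier e,
          (((1 / 2 : ℝ) • a i x + absMat (a i x)) *ᵥ ((z i).val x - (zh e).1 x))
            ⬝ᵥ ((z i).val x - (zh e).1 x) ∂(surf d))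
      + (∑ b : T.BdMortar, 1 / 2 * ∫ x in T.carrier (.inr b),
          (M x *ᵥ (zh (.inr b)).1 x) ⬝ᵥ (zh (.inr b)).1 x ∂(surf d)) = 0 := by
  have habs : ∀ i, EssBounded (fun x => absMat (a i x))
      ((surf d).restrict (frontier (T.elem i))) := fun i => (ha i).bounded.absMat (ha_symm i)
  have hZ : ∀ (e : T.Mortar) i, MemLp (z i).val 2 ((surf d).restrict (T.carrier e)) :=
    fun e i => T.memLp_carrier hd e _
  have hzh : ∀ e : T.Mortar, MemLp (zh e).1 2 ((surf d).restrict (T.carrier e)) :=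
    fun e => Lp.memLp _
  have hflux : ∀ (e : T.Mortar) (i), i ∈ T.sides e → ∀ v : Space d → Fin m → ℝ,
      MemLp v 2 ((surf d).restrict (T.carrier e)) →
      Integrable (fun x => T.flux a z zh i e x ⬝ᵥ v x) ((surf d).restrict (T.carrier e)) :=
    fun e i hi v hv => T.integrable_flux hd (fun i => (ha i).bounded) habs hi z zh hv
  -- The energy of the flux on one side of a mortar.
  have hside : ∀ (e : T.Mortar) (i), i ∈ T.sides e →
      (∫ x in T.carrier e, T.flux a z zh i e x ⬝ᵥ (z i).val x ∂(surf d))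
        - (∫ x in T.carrier e, T.flux a z zh i e x ⬝ᵥ (zh e).1 x ∂(surf d))
        - 1 / 2 * (∫ x in T.carrier e, (a i x *ᵥ (z i).val x) ⬝ᵥ (z i).val x ∂(surf d))
      = (∫ x in T.carrier e,
          (((1 / 2 : ℝ) • a i x + absMat (a i x)) *ᵥ ((z i).val x - (zh e).1 x))
            ⬝ᵥ ((z i).val x - (zh e).1 x) ∂(surf d))
        - 1 / 2 * ∫ x in T.carrier e, (a i x *ᵥ (zh e).1 x) ⬝ᵥ (zh e).1 x ∂(surf d) := by
    intro e i hi
    have hB := (ha i).bounded.mono (T.restrict_carrier_le hi)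
    have hB' := (habs i).mono (T.restrict_carrier_le hi)
    have hδ : MemLp (fun x => (z i).val x - (zh e).1 x) 2 ((surf d).restrict (T.carrier e)) :=
      (hZ e i).sub (hzh e)
    have hdiff : Integrable (fun x => T.flux a z zh i e x ⬝ᵥ (z i).val x
        - T.flux a z zh i e x ⬝ᵥ (zh e).1 x) ((surf d).restrict (T.carrier e)) :=
      (hflux e i hi _ (hZ e i)).sub (hflux e i hi _ (hzh e))
    rw [← integral_sub (hflux e i hi _ (hZ e i)) (hflux e i hi _ (hzh e)),
      ← integral_const_mul, ← integral_const_mul,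
      ← integral_sub hdiff ((hB.integrable (hZ e i) (hZ e i)).const_mul _),
      ← integral_sub (((hB.const_smul _).add hB').integrable hδ hδ)
        ((hB.integrable (hzh e) (hzh e)).const_mul _)]
    refine integral_congr_ae ?_
    filter_upwards [ae_restrict_of_ae_restrict_of_subset (T.carrier_subset_frontier hi)
      (ha_symm i)] with x hx
    exact flux_energy hx _ _
  -- The local equations, after integration by parts.
  have h1 := hloc z
  have hadv : ∀ i, ∑ k, ∫ x in T.elem i, (A k x *ᵥ (z i).val x) ⬝ᵥ (z i).deriv k x
      = 1 / 2 * ((∑ e : T.Mortar with i ∈ T.sides e,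
          ∫ x in T.carrier e, (a i x *ᵥ (z i).val x) ⬝ᵥ (z i).val x ∂(surf d))
        - ∫ x in T.elem i, (D x *ᵥ (z i).val x) ⬝ᵥ (z i).val x) := by
    intro i
    have h := (ha i).two_mul_advection hsys (T.elem_subset hΩ i) (T.isOpen_elem i)
      (isBounded_closure_openSimplex _) (surf_frontier_openSimplex_lt_top hd _)
      (fun j => (z i j : MvPolynomial (Fin d) ℝ))
    rw [T.integral_frontier_elem hd hΩ i ((ha i).bounded.integrable (T.memLp_frontier hd i _)
      (T.memLp_frontier hd i _))] at h
    change 2 * (∑ k, ∫ x in T.elem i, (A k x *ᵥ (z i).val x) ⬝ᵥ (z i).deriv k x)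
      = (∑ e : T.Mortar with i ∈ T.sides e,
          ∫ x in T.carrier e, (a i x *ᵥ (z i).val x) ⬝ᵥ (z i).val x ∂(surf d))
        - ∫ x in T.elem i, (D x *ᵥ (z i).val x) ⬝ᵥ (z i).val x at h
    linarith
  have hswap : ∀ F : Fin T.N → T.Mortar → ℝ,
      ∑ i, ∑ e : T.Mortar with i ∈ T.sides e, F i e = ∑ e, ∑ i ∈ T.sides e, F i e := fun F =>
    Finset.sum_comm' (by simp)
  rw [Finset.sum_comm, Finset.sum_congr rfl fun i _ => hadv i] at h1
  simp only [← Finset.mul_sum, Finset.sum_sub_distrib, hswap, Pi.zero_apply, zero_dotProduct,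
    integral_zero, Finset.sum_const_zero] at h1
  -- The global equations, with the interior mortars cancelling.
  have h2 := hglob zh
  have h2l : ∀ e : T.Mortar,
      ∫ x in T.carrier e, (∑ i ∈ T.sides e, T.flux a z zh i e x) ⬝ᵥ (zh e).1 x ∂(surf d)
      = ∑ i ∈ T.sides e, ∫ x in T.carrier e, T.flux a z zh i e x ⬝ᵥ (zh e).1 x ∂(surf d) := by
    intro e
    simp only [sum_dotProduct]
    exact integral_finsetSum _ fun i hi => hflux e i hi _ (hzh e)
  have h2r : ∀ b : T.BdMortar, ∫ x in T.carrier (.inr b),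
        (((1 / 2 : ℝ) • (a b.1.1 x + M x)) *ᵥ (zh (.inr b)).1 x) ⬝ᵥ (zh (.inr b)).1 x ∂(surf d)
      = 1 / 2 * (∫ x in T.carrier (.inr b),
          (a b.1.1 x *ᵥ (zh (.inr b)).1 x) ⬝ᵥ (zh (.inr b)).1 x ∂(surf d))
        + 1 / 2 * ∫ x in T.carrier (.inr b),
          (M x *ᵥ (zh (.inr b)).1 x) ⬝ᵥ (zh (.inr b)).1 x ∂(surf d) := by
    intro b
    have hB := (ha b.1.1).bounded.mono
      (T.restrict_carrier_le (e := .inr b) (Finset.mem_singleton_self _))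
    have hM' := hM.mono (T.restrict_boundary_carrier_le b)
    rw [← mul_add, ← integral_add (hB.integrable (hzh (.inr b)) (hzh (.inr b)))
      (hM'.integrable (hzh (.inr b)) (hzh (.inr b))), ← integral_const_mul]
    refine integral_congr_ae (Filter.Eventually.of_forall fun x => ?_)
    simp only [Matrix.smul_mulVec, Matrix.add_mulVec, smul_dotProduct, add_dotProduct,
      smul_eq_mul]
  simp only [h2l, h2r, Pi.zero_apply, Matrix.mulVec_zero, zero_dotProduct, integral_zero,
    Finset.sum_const_zero, neg_zero, zero_add, Finset.sum_add_distrib] at h2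
  have h3 : ∑ e : T.Mortar, ∑ i ∈ T.sides e, (1 / 2 : ℝ) * ∫ x in T.carrier e,
        (a i x *ᵥ (zh e).1 x) ⬝ᵥ (zh e).1 x ∂(surf d)
      = ∑ b : T.BdMortar, 1 / 2 * ∫ x in T.carrier (.inr b),
          (a b.1.1 x *ᵥ (zh (.inr b)).1 x) ⬝ᵥ (zh (.inr b)).1 x ∂(surf d) := by
    rw [Fintype.sum_sum_type, Finset.sum_eq_zero, zero_add]
    · exact Finset.sum_congr rfl fun b _ => Finset.sum_singleton _ _
    · intro e _
      have hlt := e.2.1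
      rw [Partition.sides, Finset.sum_pair hlt.ne, ← mul_add]
      have h4 : ∫ x in T.carrier (.inl e),
            (a e.1.1 x *ᵥ (zh (.inl e)).1 x) ⬝ᵥ (zh (.inl e)).1 x ∂(surf d)
          = ∫ x in T.carrier (.inl e),
            -((a e.1.2 x *ᵥ (zh (.inl e)).1 x) ⬝ᵥ (zh (.inl e)).1 x) ∂(surf d) := by
        refine integral_congr_ae ?_
        filter_upwards [ha_cont e.1.1 e.1.2 hlt.ne] with x hx
        rw [hx, Matrix.neg_mulVec, neg_dotProduct]
      rw [h4, integral_neg, neg_add_cancel, mul_zero]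
  have h5 := Finset.sum_congr rfl fun (e : T.Mortar) (_ : e ∈ Finset.univ) =>
    Finset.sum_congr rfl fun i hi => hside e i hi
  simp only [Finset.sum_sub_distrib, h3] at h5
  simp only [← Finset.mul_sum, Finset.sum_add_distrib] at h1 h2 h5 ⊢
  linarith

/-- The homogeneous scheme has only the trivial solution. -/
theorem Partition.eq_zero_of_homogeneous (hd : 1 ≤ d) (hΩ : interior (closure Ω) = Ω)
    (T : Partition d Ω) {p : Fin T.N → ℕ} (hsys : IsOneFieldFriedrichs Ω A D G)
    {a : Fin T.N → Space d → Matrix (Fin m) (Fin m) ℝ}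
    (ha : ∀ i, IsNormalTrace (T.elem i) A D (a i))
    (ha_symm : ∀ i, ∀ᵐ x ∂((surf d).restrict (frontier (T.elem i))), (a i x)ᵀ = a i x)
    (ha_cont : ∀ i j, i ≠ j →
      ∀ᵐ x ∂((surf d).restrict (frontier (T.elem i) ∩ frontier (T.elem j))), a i x = - a j x)
    (ha_null : ∀ i, ∀ᵐ x ∂((surf d).restrict (frontier (T.elem i))),
      ∀ v : Fin m → ℝ, a i x *ᵥ v = 0 → v = 0)
    {M : Space d → Matrix (Fin m) (Fin m) ℝ}
    (hM : EssBounded M ((surf d).restrict (frontier Ω)))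
    (hM_pos : ∀ᵐ x ∂((surf d).restrict (frontier Ω)), SemiPositive (M x))
    {z : T.VolSpace m p} {zh : T.TraceSpace m p}
    (hloc : T.LocalEq A G a 0 z zh) (hglob : T.GlobalEq a M 0 z zh) : z = 0 ∧ zh = 0 := by
  have key := T.energy_identity hd hΩ hsys ha ha_symm ha_cont hM hloc hglob
  obtain ⟨μ₀, hμ, hco⟩ := hsys.coercive_integral
  have hco' : ∀ i, μ₀ * (∫ x in T.elem i, (z i).val x ⬝ᵥ (z i).val x) ≤ _ := fun i =>
    hco (T.elem i) (T.elem_subset hΩ i) (z i).val (T.memLp_elem i _)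
  have hnn : ∀ v : Fin m → ℝ, 0 ≤ v ⬝ᵥ v := fun v => Finset.sum_nonneg fun i _ => mul_self_nonneg _
  have hZ0 : ∀ i, 0 ≤ ∫ x in T.elem i, (z i).val x ⬝ᵥ (z i).val x := fun i =>
    integral_nonneg fun x => hnn _
  have hV : ∀ i, 0 ≤ (∫ x in T.elem i, (G x *ᵥ (z i).val x) ⬝ᵥ (z i).val x)
      + 1 / 2 * ∫ x in T.elem i, (D x *ᵥ (z i).val x) ⬝ᵥ (z i).val x := fun i =>
    (mul_nonneg hμ.le (hZ0 i)).trans (hco' i)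
  have hQae : ∀ (e : T.Mortar) (i), i ∈ T.sides e →
      ∀ᵐ x ∂((surf d).restrict (T.carrier e)), (a i x)ᵀ = a i x := fun e i hi =>
    ae_restrict_of_ae_restrict_of_subset (T.carrier_subset_frontier hi) (ha_symm i)
  have hQnn : ∀ (e : T.Mortar) (i), i ∈ T.sides e →
      0 ≤ᵐ[(surf d).restrict (T.carrier e)] fun x =>
        (((1 / 2 : ℝ) • a i x + absMat (a i x)) *ᵥ ((z i).val x - (zh e).1 x))
            ⬝ᵥ ((z i).val x - (zh e).1 x) := by
    intro e i hi
    filter_upwards [hQae e i hi] with x hx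
    refine le_trans ?_ (half_absMat_le hx _)
    exact mul_nonneg (by norm_num) ((abs_nonneg _).trans (abs_dotProduct_mulVec_le hx _))
  have hQ : ∀ (e : T.Mortar) (i), i ∈ T.sides e → 0 ≤ ∫ x in T.carrier e,
        (((1 / 2 : ℝ) • a i x + absMat (a i x)) *ᵥ ((z i).val x - (zh e).1 x))
            ⬝ᵥ ((z i).val x - (zh e).1 x) ∂(surf d) := fun e i hi =>
    integral_nonneg_of_ae (hQnn e i hi)
  have hN : ∀ b : T.BdMortar, 0 ≤ 1 / 2 * ∫ x in T.carrier (.inr b),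
      (M x *ᵥ (zh (.inr b)).1 x) ⬝ᵥ (zh (.inr b)).1 x ∂(surf d) := by
    intro b
    refine mul_nonneg (by norm_num) (integral_nonneg_of_ae ?_)
    filter_upwards [ae_restrict_of_ae_restrict_of_subset Set.inter_subset_right hM_pos]
      with x hx
    rw [dotProduct_comm]
    exact hx _
  have sV := Finset.sum_nonneg fun i (_ : i ∈ Finset.univ) => hV i
  have sQ := Finset.sum_nonneg fun (e : T.Mortar) (_ : e ∈ Finset.univ) =>
    Finset.sum_nonneg fun i hi => hQ e i hi
  have sN := Finset.sum_nonneg fun b (_ : b ∈ Finset.univ) => hN b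
  have zV := (Finset.sum_eq_zero_iff_of_nonneg fun i (_ : i ∈ Finset.univ) => hV i).mp
    (by linarith)
  have zQ := (Finset.sum_eq_zero_iff_of_nonneg fun (e : T.Mortar) (_ : e ∈ Finset.univ) =>
    Finset.sum_nonneg fun i hi => hQ e i hi).mp (by linarith)
  have hz : z = 0 := by
    funext i
    have h0 : ∫ x in T.elem i, (z i).val x ⬝ᵥ (z i).val x = 0 := by
      have h1 := hco' i
      rw [zV i (Finset.mem_univ i)] at h1
      exact le_antisymm (nonpos_of_mul_nonpos_right h1 hμ) (hZ0 i)
    have hint : Integrable (fun x => (z i).val x ⬝ᵥ (z i).val x)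
        (volume.restrict (T.elem i)) := by
      have hm : MemLp (z i).val 2 (volume.restrict (T.elem i)) := T.memLp_elem i _
      simp only [dotProduct]
      exact integrable_finsetSum _ fun j _ =>
        (memLp_pi_iff.mp hm j).integrable_mul (memLp_pi_iff.mp hm j)
    have hae := (integral_eq_zero_iff_of_nonneg (fun x => hnn _) hint).mp h0
    funext j
    refine Subtype.ext (eq_zero_of_ae_eval_eq_zero (T.isOpen_elem i)
      (openSimplex_nonempty (T.simplex i)) ?_)
    filter_upwards [hae] with x hx
    exact congrFun (dotProduct_self_eq_zero.mp hx) j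
  refine ⟨hz, ?_⟩
  funext e
  obtain ⟨i, hi⟩ := T.sides_nonempty e
  have h0 := (Finset.sum_eq_zero_iff_of_nonneg fun i hi => hQ e i hi).mp
    (zQ e (Finset.mem_univ e)) i hi
  have hδ : MemLp (fun x => (z i).val x - (zh e).1 x) 2 ((surf d).restrict (T.carrier e)) :=
    (T.memLp_carrier hd e _).sub (Lp.memLp _)
  have hB := (((ha i).bounded.const_smul (1 / 2)).add ((ha i).bounded.absMat (ha_symm i))).mono
    (T.restrict_carrier_le hi)
  have hae := (integral_eq_zero_iff_of_nonneg_ae (hQnn e i hi) (hB.integrable hδ hδ)).mp h0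
  refine Subtype.ext (Lp.ext ?_)
  have hz0 : (z i).val = 0 := by
    rw [hz]
    funext x j
    simp [VecPoly.val, polyEval]
  filter_upwards [hae, hQae e i hi, ae_restrict_of_ae_restrict_of_subset
    (T.carrier_subset_frontier hi) (ha_null i),
    Lp.coeFn_zero (Fin m → ℝ) 2 ((surf d).restrict (T.carrier e))] with x h1 h2 h3 h4
  have h5 := half_absMat_le h2 ((z i).val x - (zh e).1 x)
  have h6 := (abs_nonneg _).trans (abs_dotProduct_mulVec_le h2 ((z i).val x - (zh e).1 x))
  have h7 := h3 _ (mulVec_eq_zero_of_absMat h2 (le_antisymm (by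
    simp only [Pi.zero_apply] at h1
    linarith) h6))
  rw [hz0, Pi.zero_apply, zero_sub, neg_eq_zero] at h7
  change (zh e).1 x = (0 : Lp (Fin m → ℝ) 2 ((surf d).restrict (T.carrier e))) x
  rw [h7, h4, Pi.zero_apply]

end Energy

/-! ### The scheme as a square linear system -/

section System

variable {d m : ℕ} {Ω : Set (Space d)}

/-- The values of the component on element `i`, as an element of `L²(μ)^m`. -/
noncomputable def Partition.valMap (T : Partition d Ω) {p : Fin T.N → ℕ}
    (μ : Measure (Space d)) (i : Fin T.N) : T.VolSpace m p →ₗ[ℝ] Lp (Fin m → ℝ) 2 μ :=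
  (polyLp m μ).comp (VecPoly.toPoly.comp (LinearMap.proj i))

/-- The `k`-th partial derivative of the component on element `i`, as an element of `L²(μ)^m`. -/
noncomputable def Partition.derivMap (T : Partition d Ω) {p : Fin T.N → ℕ}
    (μ : Measure (Space d)) (k : Fin d) (i : Fin T.N) :
    T.VolSpace m p →ₗ[ℝ] Lp (Fin m → ℝ) 2 μ :=
  (polyLp m μ).comp ((LinearMap.pi fun j =>
    (MvPolynomial.pderiv k).toLinearMap.comp (LinearMap.proj j)).comp
      (VecPoly.toPoly.comp (LinearMap.proj i)))

/-- The component on the mortar `e`. -/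
noncomputable def Partition.traceMap (T : Partition d Ω) {p : Fin T.N → ℕ} (e : T.Mortar) :
    T.TraceSpace m p →ₗ[ℝ] Lp (Fin m → ℝ) 2 ((surf d).restrict (T.carrier e)) :=
  (Submodule.subtype _).comp (LinearMap.proj e)

/-- The upwind flux seen from element `i` on the mortar `e`, as a functional on `L²(e)^m`. -/
noncomputable def Partition.fluxForm (T : Partition d Ω) {p : Fin T.N → ℕ}
    (a : Fin T.N → Space d → Matrix (Fin m) (Fin m) ℝ) (i : Fin T.N) (e : T.Mortar) :
    (T.VolSpace m p × T.TraceSpace m p) →ₗ[ℝ]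
      Lp (Fin m → ℝ) 2 ((surf d).restrict (T.carrier e)) →ₗ[ℝ] ℝ :=
  (coeffForm _ (a i)).comp
      ((T.valMap _ i).comp (LinearMap.fst ℝ (T.VolSpace m p) (T.TraceSpace m p)))
    + (coeffForm _ fun x => absMat (a i x)).comp
        ((T.valMap _ i).comp (LinearMap.fst ℝ (T.VolSpace m p) (T.TraceSpace m p))
          - (T.traceMap e).comp (LinearMap.snd ℝ (T.VolSpace m p) (T.TraceSpace m p)))

/-- The left-hand side of the local equations. -/
noncomputable def Partition.localForm (T : Partition d Ω) {p : Fin T.N → ℕ}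
    (A : Fin d → Space d → Matrix (Fin m) (Fin m) ℝ) (G : Space d → Matrix (Fin m) (Fin m) ℝ)
    (a : Fin T.N → Space d → Matrix (Fin m) (Fin m) ℝ) :
    (T.VolSpace m p × T.TraceSpace m p) →ₗ[ℝ] T.VolSpace m p →ₗ[ℝ] ℝ :=
  - (∑ k, ∑ i, (coeffForm (volume.restrict (T.elem i)) (A k)).compl₁₂
        ((T.valMap _ i).comp (LinearMap.fst ℝ (T.VolSpace m p) (T.TraceSpace m p)))
        (T.derivMap _ k i))
    + (∑ i, (coeffForm (volume.restrict (T.elem i)) G).compl₁₂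
        ((T.valMap _ i).comp (LinearMap.fst ℝ (T.VolSpace m p) (T.TraceSpace m p))) (T.valMap _ i))
    + ∑ i, ∑ e : T.Mortar with i ∈ T.sides e, (T.fluxForm a i e).compl₂ (T.valMap _ i)

/-- The terms of the global equations that depend on `(z, ẑ)`, collected on one side. -/
noncomputable def Partition.globalForm (T : Partition d Ω) {p : Fin T.N → ℕ}
    (a : Fin T.N → Space d → Matrix (Fin m) (Fin m) ℝ) (M : Space d → Matrix (Fin m) (Fin m) ℝ) :
    (T.VolSpace m p × T.TraceSpace m p) →ₗ[ℝ] T.TraceSpace m p →ₗ[ℝ] ℝ :=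
  (∑ e : T.Mortar, ∑ i ∈ T.sides e, (T.fluxForm a i e).compl₂ (T.traceMap e))
    - ∑ b : T.BdMortar, (coeffForm _ fun x => (1 / 2 : ℝ) • (a b.1.1 x + M x)).compl₁₂
        ((T.traceMap (.inr b)).comp (LinearMap.snd ℝ (T.VolSpace m p) (T.TraceSpace m p)))
        (T.traceMap (.inr b))

variable (T : Partition d Ω) {p : Fin T.N → ℕ}

theorem Partition.coeFn_valMap {μ : Measure (Space d)}
    (h : ∀ q : Fin m → MvPolynomial (Fin d) ℝ, MemLp (polyEval q) 2 μ) (i : Fin T.N)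
    (z : T.VolSpace m p) : T.valMap μ i z =ᵐ[μ] (z i).val :=
  coeFn_polyLp h _

theorem Partition.coeFn_derivMap {μ : Measure (Space d)}
    (h : ∀ q : Fin m → MvPolynomial (Fin d) ℝ, MemLp (polyEval q) 2 μ) (k : Fin d) (i : Fin T.N)
    (z : T.VolSpace m p) : T.derivMap μ k i z =ᵐ[μ] (z i).deriv k :=
  coeFn_polyLp h _

variable {A : Fin d → Space d → Matrix (Fin m) (Fin m) ℝ}
  {D G M : Space d → Matrix (Fin m) (Fin m) ℝ}
  {a : Fin T.N → Space d → Matrix (Fin m) (Fin m) ℝ}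

theorem Partition.fluxForm_apply (hd : 1 ≤ d)
    (ha : ∀ i, EssBounded (a i) ((surf d).restrict (frontier (T.elem i))))
    (habs : ∀ i, EssBounded (fun x => absMat (a i x)) ((surf d).restrict (frontier (T.elem i))))
    {i : Fin T.N} {e : T.Mortar} (hi : i ∈ T.sides e)
    (s : T.VolSpace m p × T.TraceSpace m p)
    {v : Lp (Fin m → ℝ) 2 ((surf d).restrict (T.carrier e))} {v' : Space d → Fin m → ℝ}
    (hv : v =ᵐ[(surf d).restrict (T.carrier e)] v') :
    T.fluxForm a i e s v = ∫ x in T.carrier e, T.flux a s.1 s.2 i e x ⬝ᵥ v' x ∂(surf d) := by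
  have hz : MemLp (s.1 i).val 2 ((surf d).restrict (T.carrier e)) := T.memLp_carrier hd e _
  have hB := (ha i).mono (T.restrict_carrier_le hi)
  have hB' := (habs i).mono (T.restrict_carrier_le hi)
  have hzδ : MemLp (fun x => (s.1 i).val x - (s.2 e).1 x) 2 ((surf d).restrict (T.carrier e)) :=
    hz.sub (Lp.memLp (s.2 e).1)
  have hv' : MemLp v' 2 ((surf d).restrict (T.carrier e)) := (memLp_congr_ae hv).mp (Lp.memLp v)
  have hval := T.coeFn_valMap (T.memLp_carrier hd e) i s.1
  have hδ : (T.valMap ((surf d).restrict (T.carrier e)) i s.1 - T.traceMap e s.2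
      : Lp (Fin m → ℝ) 2 ((surf d).restrict (T.carrier e)))
      =ᵐ[(surf d).restrict (T.carrier e)] fun x => (s.1 i).val x - (s.2 e).1 x := by
    filter_upwards [Lp.coeFn_sub (T.valMap ((surf d).restrict (T.carrier e)) i s.1)
      (T.traceMap e s.2), hval] with x h1 h2
    rw [h1, Pi.sub_apply, h2]
    rfl
  calc T.fluxForm a i e s v
      = coeffForm _ (a i) (T.valMap ((surf d).restrict (T.carrier e)) i s.1) v
        + coeffForm _ (fun x => absMat (a i x))
          (T.valMap ((surf d).restrict (T.carrier e)) i s.1 - T.traceMap e s.2) v := rfl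
    _ = _ := by
      rw [hB.coeffForm_apply hval hv, hB'.coeffForm_apply hδ hv,
        ← integral_add (hB.integrable hz hv') (hB'.integrable hzδ hv')]
      refine integral_congr_ae (Filter.Eventually.of_forall fun x => ?_)
      simp only [Partition.flux, add_dotProduct]

theorem Partition.localForm_apply (hd : 1 ≤ d)
    (hA : ∀ k i, EssBounded (A k) (volume.restrict (T.elem i)))
    (hG : ∀ i, EssBounded G (volume.restrict (T.elem i)))
    (ha : ∀ i, EssBounded (a i) ((surf d).restrict (frontier (T.elem i))))
    (habs : ∀ i, EssBounded (fun x => absMat (a i x)) ((surf d).restrict (frontier (T.elem i))))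
    (s : T.VolSpace m p × T.TraceSpace m p) (w : T.VolSpace m p) :
    T.localForm A G a s w
      = - (∑ k, ∑ i, ∫ x in T.elem i, (A k x *ᵥ (s.1 i).val x) ⬝ᵥ (w i).deriv k x)
      + (∑ i, ∫ x in T.elem i, (G x *ᵥ (s.1 i).val x) ⬝ᵥ (w i).val x)
      + (∑ i, ∑ e : T.Mortar with i ∈ T.sides e,
          ∫ x in T.carrier e, T.flux a s.1 s.2 i e x ⬝ᵥ (w i).val x ∂(surf d)) := by
  simp only [Partition.localForm, LinearMap.add_apply, LinearMap.neg_apply, LinearMap.sum_apply,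
    LinearMap.compl₁₂_apply, LinearMap.compl₂_apply, LinearMap.comp_apply, LinearMap.fst_apply]
  congr 1
  · congr 1
    · refine congrArg Neg.neg (Finset.sum_congr rfl fun k _ => Finset.sum_congr rfl fun i _ => ?_)
      exact (hA k i).coeffForm_apply (T.coeFn_valMap (T.memLp_elem i) i s.1)
        (T.coeFn_derivMap (T.memLp_elem i) k i w)
    · refine Finset.sum_congr rfl fun i _ => ?_
      exact (hG i).coeffForm_apply (T.coeFn_valMap (T.memLp_elem i) i s.1)
        (T.coeFn_valMap (T.memLp_elem i) i w)
  · refine Finset.sum_congr rfl fun i _ => Finset.sum_congr rfl fun e he => ?_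
    exact T.fluxForm_apply hd ha habs (Finset.mem_filter.mp he).2 s
      (T.coeFn_valMap (T.memLp_carrier hd e) i w)

theorem Partition.essBounded_boundary_carrier
    (ha : ∀ i, EssBounded (a i) ((surf d).restrict (frontier (T.elem i))))
    (b : T.BdMortar) : EssBounded (a b.1.1) ((surf d).restrict (T.carrier (.inr b))) :=
  (ha b.1.1).mono (T.restrict_carrier_le (e := .inr b) (Finset.mem_singleton_self _))

theorem Partition.globalForm_apply (hd : 1 ≤ d)
    (ha : ∀ i, EssBounded (a i) ((surf d).restrict (frontier (T.elem i))))
    (habs : ∀ i, EssBounded (fun x => absMat (a i x)) ((surf d).restrict (frontier (T.elem i))))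
    (hM : EssBounded M ((surf d).restrict (frontier Ω)))
    (s : T.VolSpace m p × T.TraceSpace m p) (wh : T.TraceSpace m p) :
    T.globalForm a M s wh
      = (∑ e : T.Mortar, ∫ x in T.carrier e,
          (∑ i ∈ T.sides e, T.flux a s.1 s.2 i e x) ⬝ᵥ (wh e).1 x ∂(surf d))
        - ∑ b : T.BdMortar, ∫ x in T.carrier (.inr b),
            (((1 / 2 : ℝ) • (a b.1.1 x + M x)) *ᵥ (s.2 (.inr b)).1 x) ⬝ᵥ (wh (.inr b)).1 x
              ∂(surf d) := by
  simp only [Partition.globalForm, LinearMap.sub_apply, LinearMap.sum_apply,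
    LinearMap.compl₁₂_apply, LinearMap.compl₂_apply, LinearMap.comp_apply, LinearMap.snd_apply]
  congr 1
  · refine Finset.sum_congr rfl fun e _ => ?_
    simp only [sum_dotProduct]
    rw [integral_finsetSum _ fun i hi =>
      T.integrable_flux hd ha habs hi s.1 s.2 (Lp.memLp (wh e).1)]
    refine Finset.sum_congr rfl fun i hi => ?_
    exact T.fluxForm_apply hd ha habs hi s (Filter.EventuallyEq.refl _ _)
  · refine Finset.sum_congr rfl fun b _ => ?_
    exact (((T.essBounded_boundary_carrier ha b).add
      (hM.mono (T.restrict_boundary_carrier_le b))).const_smul _).coeffForm_apply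
        (Filter.EventuallyEq.refl _ _) (Filter.EventuallyEq.refl _ _)

theorem Partition.exists_volume_load {f : Space d → Fin m → ℝ}
    (hf : ∀ i, MemLp f 2 (volume.restrict (T.elem i))) :
    ∃ l : T.VolSpace m p →ₗ[ℝ] ℝ, ∀ w, l w = ∑ i, ∫ x in T.elem i, f x ⬝ᵥ (w i).val x := by
  have h1 : ∀ i, EssBounded (fun _ => (1 : Matrix (Fin m) (Fin m) ℝ))
      (volume.restrict (T.elem i)) := fun i j k => memLp_top_const _
  refine ⟨∑ i, (coeffForm (volume.restrict (T.elem i)) (fun _ => 1) (hf i).toLp).comp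
    (T.valMap _ i), fun w => ?_⟩
  rw [LinearMap.sum_apply]
  refine Finset.sum_congr rfl fun i _ => ?_
  have h := (h1 i).coeffForm_apply (hf i).coeFn_toLp (T.coeFn_valMap (T.memLp_elem i) i w)
  simp only [Matrix.one_mulVec] at h
  exact h

theorem Partition.exists_boundary_load {g : Space d → Fin m → ℝ}
    (ha : ∀ i, EssBounded (a i) ((surf d).restrict (frontier (T.elem i))))
    (hM : EssBounded M ((surf d).restrict (frontier Ω)))
    (hg : MemLp g 2 ((surf d).restrict (frontier Ω))) :
    ∃ l : T.TraceSpace m p →ₗ[ℝ] ℝ, ∀ wh, l wh = - ∑ b : T.BdMortar,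
      ∫ x in T.carrier (.inr b), (((1 / 2 : ℝ) • (a b.1.1 x - M x)) *ᵥ g x)
        ⬝ᵥ (wh (.inr b)).1 x ∂(surf d) := by
  have hgb := fun b : T.BdMortar => hg.mono_measure (T.restrict_boundary_carrier_le b)
  refine ⟨-∑ b : T.BdMortar, (coeffForm _ (fun x => (1 / 2 : ℝ) • (a b.1.1 x - M x))
    (hgb b).toLp).comp (T.traceMap (.inr b)), fun wh => ?_⟩
  rw [LinearMap.neg_apply, LinearMap.sum_apply]
  refine congrArg Neg.neg (Finset.sum_congr rfl fun b _ => ?_)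
  exact (((T.essBounded_boundary_carrier ha b).sub
    (hM.mono (T.restrict_boundary_carrier_le b))).const_smul _).coeffForm_apply
      (hgb b).coeFn_toLp (Filter.EventuallyEq.refl _ _)

theorem Partition.finiteDimensional_traceSpace (hd : 1 ≤ d) :
    FiniteDimensional ℝ (T.TraceSpace m p) := by
  have h : ∀ e : T.Mortar,
      FiniteDimensional ℝ (polyTrace m (T.mortarDeg p e) (T.carrier e)) := by
    intro e
    rw [polyTrace_eq_map (T.memLp_carrier hd e)]
    infer_instance
  infer_instance

end System


end HDG

theorem mainTheorem1 {d m : ℕ} (hd : 1 ≤ d) (Ω : Set (HDG.Space d))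
    (hΩ : interior (closure Ω) = Ω) (T : HDG.Partition d Ω) (p : Fin T.N → ℕ)
    (A : Fin d → HDG.Space d → Matrix (Fin m) (Fin m) ℝ)
    (D G : HDG.Space d → Matrix (Fin m) (Fin m) ℝ)
    (hsys : HDG.IsOneFieldFriedrichs Ω A D G)
    (a : Fin T.N → HDG.Space d → Matrix (Fin m) (Fin m) ℝ)
    (ha : ∀ i, HDG.IsNormalTrace (T.elem i) A D (a i))
    (ha_cont : ∀ i j, i ≠ j →
      ∀ᵐ x ∂((HDG.surf d).restrict (frontier (T.elem i) ∩ frontier (T.elem j))), a i x = - a j x)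
    (ha_null : ∀ i, ∀ᵐ x ∂((HDG.surf d).restrict (frontier (T.elem i))),
      ∀ v : Fin m → ℝ, a i x *ᵥ v = 0 → v = 0)
    (M : HDG.Space d → Matrix (Fin m) (Fin m) ℝ)
    (hM : HDG.EssBounded M ((HDG.surf d).restrict (frontier Ω)))
    (hM_pos : ∀ᵐ x ∂((HDG.surf d).restrict (frontier Ω)), HDG.SemiPositive (M x))
    (f : HDG.Space d → Fin m → ℝ)
    (hf : MeasureTheory.MemLp f 2 (MeasureTheory.volume.restrict Ω))
    (g : HDG.Space d → Fin m → ℝ)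
    (hg : MeasureTheory.MemLp g 2 ((HDG.surf d).restrict (frontier Ω))) :
    ∃! s : T.VolSpace m p × T.TraceSpace m p,
      T.LocalEq A G a f s.1 s.2 ∧ T.GlobalEq a M g s.1 s.2 := by
  have hopen : IsOpen Ω := hΩ ▸ isOpen_interior
  have hle : ∀ i, MeasureTheory.volume.restrict (T.elem i) ≤ MeasureTheory.volume.restrict Ω :=
    fun i => MeasureTheory.Measure.restrict_mono (T.elem_subset hΩ i) le_rfl
  have hsymm := fun i => (ha i).symm hsys hopen (T.elem_subset hΩ i)
    (HDG.surf_frontier_openSimplex_lt_top hd _)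
  have habd := fun i => (ha i).bounded
  have habs := fun i => (ha i).bounded.absMat (hsymm i)
  have hloc := T.localForm_apply (p := p) hd (fun k i => (hsys.A_bounded k).mono (hle i))
    (fun i => hsys.G_bounded.mono (hle i)) habd habs
  have hglob := T.globalForm_apply (p := p) hd habd habs hM
  have := T.finiteDimensional_traceSpace (m := m) (p := p) hd
  let L := (T.localForm (p := p) A G a).prod (T.globalForm (p := p) a M)
  have hinj : Function.Injective L := by
    rw [← LinearMap.ker_eq_bot, LinearMap.ker_eq_bot']
    intro s hs
    have h1 : T.localForm A G a s = 0 := congrArg Prod.fst hs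
    have h2 : T.globalForm a M s = 0 := congrArg Prod.snd hs
    have h3 := T.eq_zero_of_homogeneous hd hΩ hsys ha hsymm ha_cont ha_null hM hM_pos
      (z := s.1) (zh := s.2) (fun w => ?_) (fun wh => ?_)
    · exact Prod.ext h3.1 h3.2
    · rw [← hloc, h1]
      simp
    · have h4 := hglob s wh
      rw [h2, LinearMap.zero_apply, eq_comm, sub_eq_zero] at h4
      rw [h4]
      simp
  have hsurj : Function.Surjective L := by
    refine (LinearMap.injective_iff_surjective_of_finrank_eq_finrank ?_).mp hinj
    rw [Module.finrank_prod, Module.finrank_prod]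
    exact congrArg₂ _ Subspace.dual_finrank_eq.symm Subspace.dual_finrank_eq.symm
  obtain ⟨lf, hlf⟩ := T.exists_volume_load (p := p) fun i => hf.mono_measure (hle i)
  obtain ⟨lg, hlg⟩ := T.exists_boundary_load (p := p) habd hM hg
  have hiff : ∀ s : T.VolSpace m p × T.TraceSpace m p,
      T.LocalEq A G a f s.1 s.2 ∧ T.GlobalEq a M g s.1 s.2 ↔ L s = (lf, lg) := by
    intro s
    rw [Prod.ext_iff, LinearMap.ext_iff, LinearMap.ext_iff]
    refine and_congr (forall_congr' fun w => ?_) (forall_congr' fun wh => ?_)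
    · change _ ↔ T.localForm A G a s w = lf w
      rw [hloc, hlf]
    · change _ ↔ T.globalForm a M s wh = lg wh
      rw [hglob, hlg, sub_eq_iff_eq_add]
  obtain ⟨s, hs⟩ := hsurj (lf, lg)
  exact ⟨s, (hiff s).mpr hs, fun s' hs' => hinj (((hiff s').mp hs').trans hs.symm)⟩
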